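/- Let $d\in\mathbb N$ and let $\Omega=C^3(\mathbb R^d;\mathbb R)$ carry the Fréchet topology of uniform convergence on compact sets of all derivatives of order at most $3$, and its Borel $\sigma$-algebra. Put $\tau_x h=h(\cdot+x)$. Let $\mathbb P$ be a Borel probability measure on $\Omega$ such that - (stationarity) $\mathbb P(\tau_x^{-1}B)=\mathbb P(B)$ for all Borel $B$ and $x\in\mathbb R^d$; - (ergodicity) if $B$ is Borel and $\tau_x(B)=B$ for all $x$, then $\mathbb P(B)\in\{0,1\}$; - (stochastic continuity) $\tau_x h\to h$ in $\mathbb P$-probability as $x\to0$, in the topology of $\Omega$; - (bounded derivatives) there is $K>0$ such that $\mathbb P$-almost surely $|\nabla h(x)|+|\nabla\nabla h(x)|\le K$ for all $x\in\mathbb R^d$. Write $g(x,h)=I+\nabla h(x)\otimes\nabla h(x)$, $|g|=\det g$, $g(h)=g(0,h)$, $Z=\int_\Omega\sqrt{|g|(h)}\,\mathbb P(dh)$, $\pi(dh)=Z^{-1}\sqrt{|g|(h)}\,\mathbb P(dh)$ and, for $e\in\mathbb R^d$, let $F^e(h)=e\cdot\big(|g|^{-1/2}\,\nabla\cdot(\sqrt{|g|}\,g^{-1})\big)(x,h)\big|_{x=0}$.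 Let $D_i$ be the $L^2(\mathbb P)$-generator of $V\mapsto V\circ\tau_{\lambda e_i}$, $H^1=\bigcap_i\mathcal D(D_i)$, $\mathbb DV=(D_iV)_i$ for $V\in H^1$, and let $L^2_{pot}(\mathbb P)$ be the closure of $\mathbb D(H^1)$ in $(L^2(\mathbb P))^d$. Let $\mathcal L$ be the self-adjoint operator on $L^2(\pi)$ whose Dirichlet form is $$\langle-\mathcal Lf,\psi\rangle_{L^2(\pi)}=\frac1Z\int_\Omega\mathbb Df\cdot g^{-1}\,\mathbb D\psi\,\sqrt{|g|}\,d\mathbb P,\qquad \psi\in H^1,$$ with form domain $H^1$. For $\lambda>0$ let $\chi^e_\lambda$ solve $(\lambda-\mathcal L)\chi^e_\lambda=F^e$, and let $\mathbb D\chi^e\in(L^2(\mathbb P))^d$ be the limit of $\mathbb D\chi^e_\lambda$ as $\lambda\to0$ in the norm $G\mapsto\big(\frac1Z\int_\Omega G\cdot g^{-1}G\sqrt{|g|}\,d\mathbb P\big)^{1/2}$. With $(\mathbb D\chi)_{ij}=D_j\chi^{e_i}$, the effective diffusion tensor is $$D=\frac1Z\int_\Omega(I+\mathbb D\chi)\,g^{-1}\,(I+\mathbb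 D\chi)^\top\sqrt{|g|}\,d\mathbb P .$$ **Theorem.** For every $e\in\mathbb R^d$ the limit $\mathbb D\chi^e$ exists and is unique, so that $D$ is well defined, and $D$ has the following properties. 1. $D$ is (symmetric and) strictly positive definite. 2. For all $e\in\mathbb R^d$, $$e\cdot De=\frac1Z\inf_{V\in L^2_{pot}(\mathbb P)}\int_\Omega(e+V)\cdot g^{-1}(e+V)\sqrt{|g|}\,d\mathbb P,$$ and $V=\mathbb D\chi^e$ is the unique minimiser in $L^2_{pot}(\mathbb P)$. 3. For all $e\in\mathbb R^d$, $e\cdot D_*e\le e\cdot De\le e\cdot D^*e$, where $$D^*=\frac1Z\int_\Omega g^{-1}\sqrt{|g|}\,d\mathbb P,\qquad D_*=\frac1Z\Big(\int_\Omega\frac{g}{\sqrt{|g|}}\,d\mathbb P\Big)^{-1}.$$ 4. For all unit vectors $e\in\mathbb R^d$, $\frac1{Z^2}\le e\cdot De\le1$. -/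

import Mathlib

open MeasureTheory Filter Topology Matrix

noncomputable section

namespace RandomSurface

/-- The plane `ℝ^d` with its Euclidean structure. -/
abbrev E (d : ℕ) : Type := EuclideanSpace ℝ (Fin d)

/-- The sample space `Ω`: all `C^3` functions `ℝ^d → ℝ`. -/
def Surf (d : ℕ) : Type := {h : E d → ℝ // ContDiff ℝ 3 h}

variable {d : ℕ}

instance : CoeFun (Surf d) (fun _ => E d → ℝ) := ⟨Subtype.val⟩

/-- The derivative of order `k ≤ 3` of `h`, as a continuous function on `ℝ^d`. -/
def jet (h : Surf d) (k : Fin 4) : C(E d, E d [×(k : ℕ)]→L[ℝ] ℝ) where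
  toFun := iteratedFDeriv ℝ k h
  continuous_toFun := h.2.continuous_iteratedFDeriv (by
    have hk : (k : ℕ) ≤ 3 := by omega
    exact_mod_cast hk)

/-- The Fréchet topology of `C^3(ℝ^d)`: uniform convergence on compact sets of all derivatives
of order at most `3` (`C(X, Y)` carries the compact-open topology). -/
instance : TopologicalSpace (Surf d) := TopologicalSpace.induced jet inferInstance

instance : MeasurableSpace (Surf d) := borel (Surf d)

instance : BorelSpace (Surf d) := ⟨rfl⟩

/-- The seminorm `sup_{|x| ≤ N} ∑_{k ≤ 3} |∇^k f(x)|`. -/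
def c3Seminorm (N : ℕ) (f : E d → ℝ) : ℝ :=
  ⨆ x : Metric.closedBall (0 : E d) N, ∑ k ∈ Finset.range 4, ‖iteratedFDeriv ℝ k f x‖

/-- The translation `τ_x h = h(· + x)`. -/
def shift (x : E d) (h : Surf d) : Surf d :=
  ⟨fun y => h (y + x), h.2.comp (contDiff_id.add contDiff_const)⟩

/-! ### Assumptions on the law `P` of the random field -/

/-- Stationarity. -/
def Stationary (P : Measure (Surf d)) : Prop :=
  ∀ B : Set (Surf d), MeasurableSet B → ∀ x : E d, P ((shift x : Surf d → Surf d) ⁻¹' B) = P B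

/-- Ergodicity under the group of translations. -/
def ErgodicField (P : Measure (Surf d)) : Prop :=
  ∀ B : Set (Surf d), MeasurableSet B → (∀ x : E d, (shift x : Surf d → Surf d) '' B = B) → P B = 0 ∨ P B = 1

/-- Stochastic continuity: `τ_x h → h` in probability, with respect to each of the seminorms
that generate the metric of `Ω`. -/
def StochasticallyContinuous (P : Measure (Surf d)) : Prop :=
  ∀ N : ℕ, ∀ δ : ℝ, 0 < δ →
    Tendsto (fun x : E d => P {h : Surf d | δ < c3Seminorm N (fun y => shift x h y - h y)})
      (𝓝 0) (𝓝 0)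

/-- Almost surely the first two derivatives of the field are bounded by one constant. -/
def BoundedDerivatives (P : Measure (Surf d)) : Prop :=
  ∃ K : ℝ, 0 < K ∧ ∀ᵐ h : Surf d ∂P, ∀ x : E d, ‖gradient h x‖ + ‖iteratedFDeriv ℝ 2 h x‖ ≤ K

/-! ### Metric tensor, surface area, drift -/

/-- The metric tensor `g(x, h) = I + ∇h(x) ⊗ ∇h(x)`. -/
def metric (x : E d) (h : Surf d) : Matrix (Fin d) (Fin d) ℝ :=
  1 + vecMulVec (gradient h x).ofLp (gradient h x).ofLp

/-- The area element `√|g|(x, h)`. -/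
def areaAt (x : E d) (h : Surf d) : ℝ := √(metric x h).det

/-- The random matrix `g(h) = g(0, h)`. -/
def g (h : Surf d) : Matrix (Fin d) (Fin d) ℝ := metric 0 h

/-- The random variable `√|g|(h) = √|g|(0, h)`. -/
def area (h : Surf d) : ℝ := areaAt 0 h

/-- The average surface area `Z`. -/
def Z (P : Measure (Surf d)) : ℝ := ∫ h, area h ∂P

/-- The probability measure `π(dh) = (√|g|(h) / Z) P(dh)`. -/
def piMeasure (P : Measure (Surf d)) : Measure (Surf d) :=
  P.withDensity (fun h => ENNReal.ofReal (area h / Z P))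

/-- The component `F(h) · e` of the drift `F(h) = |g|^{-1/2} ∇ · (√|g| g⁻¹)`, evaluated at
`x = 0`. -/
def drift (e : E d) (h : Surf d) : ℝ :=
  (area h)⁻¹ * ∑ k, ∑ j,
    fderiv ℝ (fun x => areaAt x h * (metric x h)⁻¹ j k) 0 (EuclideanSpace.single j 1) * e k

/-! ### Derivatives along translations -/

/-- The bilinear form `u · A v`. -/
def form (A : Matrix (Fin d) (Fin d) ℝ) (u v : E d) : ℝ := u.ofLp ⬝ᵥ (A *ᵥ v.ofLp)

/-- `V` lies in `H^1 = ⋂ᵢ 𝒟(Dᵢ)` and `G = 𝔻 V`: for each `i` the difference quotient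
`(V(τ_{t eᵢ} h) - V(h)) / t` converges to `Gᵢ` in `L²(P)` as `t → 0`. -/
def HasGrad (P : Measure (Surf d)) (V : Lp ℝ 2 P) (G : Lp (E d) 2 P) : Prop :=
  ∀ i : Fin d, Tendsto
    (fun t : ℝ => eLpNorm
      (fun h => t⁻¹ * (V (shift (EuclideanSpace.single i t) h) - V h) - G h i) 2 P)
    (𝓝[≠] 0) (𝓝 0)

/-- Potential fields: the closure in `L²(P)^d` of the range of `𝔻` on `H^1`. -/
def L2pot (P : Measure (Surf d)) : Set (Lp (E d) 2 P) :=
  closure {G | ∃ V : Lp ℝ 2 P, HasGrad P V G}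

/-- The Dirichlet form `(1/Z) ∫ G · g⁻¹ Γ √|g| dP`, in terms of the gradients. -/
def dirichletForm (P : Measure (Surf d)) (G Γ : Lp (E d) 2 P) : ℝ :=
  (Z P)⁻¹ * ∫ h, form (g h)⁻¹ (G h) (Γ h) * area h ∂P

/-- `f` lies in the domain of the generator `ℒ`, and `ℒ f = φ`. Here `ℒ` is the self-adjoint
operator on `L²(π)` of the Dirichlet form with domain `H^1`:
`⟨-ℒ f, ψ⟩_{L²(π)} = (1/Z) ∫ 𝔻f · g⁻¹ 𝔻ψ √|g| dP` for all `ψ ∈ H^1`. -/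
def IsGenerator (P : Measure (Surf d)) (f : Lp ℝ 2 P) (φ : Surf d → ℝ) : Prop :=
  MemLp φ 2 (piMeasure P) ∧
    ∃ G : Lp (E d) 2 P, HasGrad P f G ∧
      ∀ (ψ : Lp ℝ 2 P) (Γ : Lp (E d) 2 P), HasGrad P ψ Γ →
        ∫ h, φ h * ψ h ∂(piMeasure P) = - dirichletForm P G Γ

/-- `χ` is the `lam`-corrector in direction `e`, that is `(lam - ℒ) χ = F · e`. -/
def IsCorrector (P : Measure (Surf d)) (e : E d) (lam : ℝ) (χ : Lp ℝ 2 P) : Prop :=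
  ∃ φ : Surf d → ℝ, IsGenerator P χ φ ∧ ∀ᵐ h ∂P, lam * χ h - φ h = drift e h

/-- `G` is the gradient `𝔻 χ^e` of the limit `χ^e` of the `lam`-correctors as `lam → 0`, in the
completed space `ℋ₁`, whose norm is the square root of the Dirichlet form. -/
def IsGradChi (P : Measure (Surf d)) (e : E d) (G : Lp (E d) 2 P) : Prop :=
  ∃ (χ : ℝ → Lp ℝ 2 P) (Γ : ℝ → Lp (E d) 2 P),
    (∀ lam : ℝ, 0 < lam → IsCorrector P e lam (χ lam) ∧ HasGrad P (χ lam) (Γ lam)) ∧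
    Tendsto (fun lam : ℝ => dirichletForm P (Γ lam - G) (Γ lam - G)) (𝓝[>] 0) (𝓝 0)

/-- The gradient `𝔻 χ^e` (the field singled out by `IsGradChi`). -/
def gradChi (P : Measure (Surf d)) (e : E d) : Lp (E d) 2 P :=
  Classical.epsilon (IsGradChi P e)

/-- The matrix field `𝔻 χ`, with `(𝔻 χ)ᵢⱼ = Dⱼ χ^{eᵢ}`. -/
def gradChiMatrix (P : Measure (Surf d)) (h : Surf d) : Matrix (Fin d) (Fin d) ℝ :=
  Matrix.of fun i j => gradChi P (EuclideanSpace.single i 1) h j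

/-- The effective diffusion tensor
`D = (1/Z) ∫ (I + 𝔻χ) g⁻¹ (I + 𝔻χ)ᵀ √|g| dP`. -/
def effTensor (P : Measure (Surf d)) : Matrix (Fin d) (Fin d) ℝ :=
  Matrix.of fun i j => (Z P)⁻¹ * ∫ h,
    ((1 + gradChiMatrix P h) * (g h)⁻¹ * (1 + gradChiMatrix P h)ᵀ : Matrix (Fin d) (Fin d) ℝ) i j
      * area h ∂P

/-- The functional `V ↦ ∫ (e + V) · g⁻¹ (e + V) √|g| dP`. -/
def cellEnergy (P : Measure (Surf d)) (e : E d) (V : Lp (E d) 2 P) : ℝ :=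
  ∫ h, form (g h)⁻¹ (e + V h) (e + V h) * area h ∂P

/-- The upper bound `D^* = (1/Z) ∫ g⁻¹ √|g| dP`. -/
def upperTensor (P : Measure (Surf d)) : Matrix (Fin d) (Fin d) ℝ :=
  (Z P)⁻¹ • Matrix.of fun i j => ∫ h, (g h)⁻¹ i j * area h ∂P

/-- The lower bound `D_* = (1/Z) (∫ g / √|g| dP)⁻¹`. -/
def lowerTensor (P : Measure (Surf d)) : Matrix (Fin d) (Fin d) ℝ :=
  (Z P)⁻¹ • (Matrix.of fun i j => ∫ h, g h i j / area h ∂P)⁻¹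

end RandomSurface

end

open RandomSurface

open MeasureTheory Filter Topology Matrix

noncomputable section

namespace RandomSurface

/-! ### Coercive forms on closed graphs and generators of isometry groups. -/

section

/-! As `∇h` is almost surely bounded, the coefficient `√|g| g⁻¹` is symmetric, bounded and uniformly
elliptic, so the Dirichlet form `a` is a scalar product equivalent to that of `L²(P)^d`. By
stationarity the translations along each axis form a group of isometries of `L²(P)`; its generator
is closed and skew. Integration by parts (`HasGrad.integral_fderiv_flux`) turns the drift into the
divergence of the flux, and the corrector equation becomes `lam ⟨χ, ψ⟩_π + a(e + 𝔻χ, 𝔻ψ) = 0` for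
all `ψ ∈ H^1` (`isCorrector_iff`).

Lax-Milgram on the closed graph of `𝔻` solves this for each `lam > 0`. Let `G₀` be the
`a`-orthogonal projection of `-e` onto `L²_pot`. The corrector minimises `lam ‖χ‖²_π + a(𝔻χ - G₀, 𝔻χ
- G₀)` over the graph, and gradients are dense in `L²_pot`, so `𝔻χ_lam → G₀` (`tendsto_resolvent`).
Hence `𝔻χ^e = G₀`, which says that `e + 𝔻χ^e` is `a`-orthogonal to `L²_pot`.

The rest follows from this orthogonality. Pythagoras (`dirichletForm_cst_add`) gives the variational
formula and the unique minimiser; linearity of `e ↦ 𝔻χ^e` identifies `e · De` with the minimal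
energy. The competitor `V = 0` gives the upper bounds. For the lower bounds, pointwise Legendre
duality with a constant field `p` bounds the energy below by `2 p · e - p · Mp`, where `M = ∫ g/√|g|
dP`, because potential fields have mean zero (`le_cellEnergy`). The choice `p = M⁻¹e` yields `D_*`.
The choice `p = e/Z`, with `M ≤ Z`, yields `1/Z²`, and with it positive definiteness. -/

theorem exists_forall_eq_of_isCoercive {V : Type*} [NormedAddCommGroup V] [InnerProductSpace ℝ V]
    [CompleteSpace V] (B : V →L[ℝ] V →L[ℝ] ℝ) (hB : IsCoercive B) (l : V →L[ℝ] ℝ) :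
    ∃ u, ∀ w, B u w = l w := by
  obtain ⟨u, hu⟩ := hB.continuousLinearEquivOfBilin.surjective
    ((InnerProductSpace.toDual ℝ V).symm l)
  refine ⟨u, fun w => ?_⟩
  rw [← hB.continuousLinearEquivOfBilin_apply, hu, InnerProductSpace.toDual_symm_apply]

section Abstract

variable {L H : Type*} [NormedAddCommGroup L] [InnerProductSpace ℝ L] [CompleteSpace L]
  [NormedAddCommGroup H] [InnerProductSpace ℝ H] [CompleteSpace H]

/-- Projection onto a closed subspace with respect to a coercive form. -/
theorem exists_mem_forall_eq (a : H →L[ℝ] H →L[ℝ] ℝ) (ha : IsCoercive a) (S : Submodule ℝ H)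
    (hS : IsClosed (S : Set H)) (l : H →L[ℝ] ℝ) : ∃ u ∈ S, ∀ w ∈ S, a u w = l w := by
  have : CompleteSpace S := hS.completeSpace_coe
  obtain ⟨C, hC, hCa⟩ := ha
  obtain ⟨u, hu⟩ := exists_forall_eq_of_isCoercive (a.bilinearComp S.subtypeL S.subtypeL)
    ⟨C, hC, fun u => by simpa using hCa u⟩ (l.comp S.subtypeL)
  exact ⟨u, u.2, fun w hw => by simpa using hu ⟨w, hw⟩⟩

/-- The resolvent equation of a form on a closed graph. -/
theorem exists_resolvent (a : H →L[ℝ] H →L[ℝ] ℝ) (ha : IsCoercive a)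
    (b : L →L[ℝ] L →L[ℝ] ℝ) (hb : IsCoercive b) (S : Submodule ℝ (WithLp 2 (L × H)))
    (hS : IsClosed (S : Set (WithLp 2 (L × H)))) {lam : ℝ} (hlam : 0 < lam) (l : H →L[ℝ] ℝ) :
    ∃ p ∈ S, ∀ q ∈ S, lam * b p.fst q.fst + a p.snd q.snd = l q.snd := by
  obtain ⟨C, hC, hCa⟩ := ha
  obtain ⟨C', hC', hCb⟩ := hb
  let f : WithLp 2 (L × H) →L[ℝ] L := WithLp.fstL 2 ℝ L H
  let s : WithLp 2 (L × H) →L[ℝ] H := WithLp.sndL 2 ℝ L H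
  -- The two forms control one component each, so the sum is coercive in the graph norm; the
  -- constant degenerates as `lam → 0`, which is harmless at fixed `lam`.
  have hco : IsCoercive (lam • b.bilinearComp f f + a.bilinearComp s s) := by
    refine ⟨min (lam * C') C, by positivity, fun u => ?_⟩
    have h1 : ‖u‖ * ‖u‖ = ‖u.fst‖ * ‖u.fst‖ + ‖u.snd‖ * ‖u.snd‖ := by
      have := WithLp.prod_norm_sq_eq_of_L2 u
      nlinarith
    have h2 := mul_le_mul_of_nonneg_right (min_le_left (lam * C') C)
      (mul_self_nonneg ‖u.fst‖)
    have h3 := mul_le_mul_of_nonneg_right (min_le_right (lam * C') C)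
      (mul_self_nonneg ‖u.snd‖)
    have h4 := mul_le_mul_of_nonneg_left (hCb u.fst) hlam.le
    have h5 := hCa u.snd
    change _ ≤ lam * b u.fst u.fst + a u.snd u.snd
    rw [mul_assoc, h1]
    nlinarith
  obtain ⟨p, hp, h⟩ := exists_mem_forall_eq _ hco S hS (l.comp s)
  exact ⟨p, hp, fun q hq => h q hq⟩

theorem form_add {V : Type*} [NormedAddCommGroup V] [InnerProductSpace ℝ V] (a : V →L[ℝ] V →L[ℝ] ℝ)
    (ha : ∀ u v, a u v = a v u) (u v : V) :
    a (u + v) (u + v) = a u u + 2 * a u v + a v v := by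
  simp only [map_add, _root_.add_apply, ha v u]
  ring

omit [CompleteSpace L] [CompleteSpace H] in
/-- Vanishing-regularisation limit of the resolvent equation. -/
theorem tendsto_resolvent (a : H →L[ℝ] H →L[ℝ] ℝ) (ha : ∀ u, 0 ≤ a u u)
    (ha' : ∀ u v, a u v = a v u) (b : L →L[ℝ] L →L[ℝ] ℝ) (hb : ∀ u, 0 ≤ b u u)
    (hb' : ∀ u v, b u v = b v u) (S : Submodule ℝ (WithLp 2 (L × H))) (G : H)
    (hG : G ∈ closure {y | ∃ x, WithLp.toLp 2 (x, y) ∈ S}) (p : ℝ → WithLp 2 (L × H))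
    (hpS : ∀ lam, 0 < lam → p lam ∈ S)
    (hp : ∀ lam, 0 < lam → ∀ q ∈ S,
      lam * b (p lam).fst q.fst + a ((p lam).snd - G) q.snd = 0) :
    Tendsto (fun lam => a ((p lam).snd - G) ((p lam).snd - G)) (𝓝[>] 0) (𝓝 0) := by
  rw [Metric.tendsto_nhds]
  intro ε hε
  have hc : Continuous fun y : H => a (y - G) (y - G) := by fun_prop
  have hmem : {y : H | a (y - G) (y - G) < ε / 2} ∈ 𝓝 G :=
    (isOpen_lt hc continuous_const).mem_nhds (by simpa using half_pos hε)
  obtain ⟨y, hy, x, hx⟩ := mem_closure_iff_nhds.1 hG _ hmem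
  have hl : Tendsto (fun lam : ℝ => lam * b x x) (𝓝[>] 0) (𝓝 0) := by
    have : Tendsto (fun lam : ℝ => lam * b x x) (𝓝 0) (𝓝 (0 * b x x)) :=
      Continuous.tendsto (by fun_prop) _
    simpa using this.mono_left nhdsWithin_le_nhds
  filter_upwards [hl.eventually (gt_mem_nhds (half_pos hε)), self_mem_nhdsWithin] with lam h1 h2
  have hlam : 0 < lam := h2
  -- Testing with `(x, y) - p lam` makes the cross terms of the two squares below cancel. What
  -- remains is `a(p.snd - G, p.snd - G) ≤ lam b(x, x) + a(y - G, y - G)`, small once `y` is chosen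
  -- near `G` and then `lam` near `0`.
  have hq := hp lam hlam _ (S.sub_mem hx (hpS lam hlam))
  change lam * b (p lam).fst (x - (p lam).fst) + a ((p lam).snd - G) (y - (p lam).snd) = 0 at hq
  have e1 : b x x = b (p lam).fst (p lam).fst + 2 * b (p lam).fst (x - (p lam).fst)
      + b (x - (p lam).fst) (x - (p lam).fst) := by
    simpa using form_add b hb' (p lam).fst (x - (p lam).fst)
  have e2 : a (y - G) (y - G) = a ((p lam).snd - G) ((p lam).snd - G)
      + 2 * a ((p lam).snd - G) (y - (p lam).snd)
      + a (y - (p lam).snd) (y - (p lam).snd) := by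
    rw [← form_add a ha', sub_add_sub_cancel']
  have p1 := mul_nonneg hlam.le (hb (x - (p lam).fst))
  have p2 := mul_nonneg hlam.le (hb (p lam).fst)
  have p3 := ha (y - (p lam).snd)
  have p4 : a (y - G) (y - G) < ε / 2 := hy
  rw [Real.dist_eq, sub_zero, abs_of_nonneg (ha _)]
  have h3 : lam * b x x = lam * b (p lam).fst (p lam).fst
      + 2 * (lam * b (p lam).fst (x - (p lam).fst))
      + lam * b (x - (p lam).fst) (x - (p lam).fst) := by rw [e1]; ring
  linarith

omit [CompleteSpace L] in
/-- The infinitesimal generator of a one-parameter family of isometries is closed. -/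
theorem isClosed_hasDerivAt_zero (U : ℝ → L →ₗᵢ[ℝ] L)
    (hU : ∀ s t x, U (s + t) x = U s (U t x)) :
    IsClosed {p : L × L | HasDerivAt (fun t => U t p.1) p.2 0} := by
  rw [← isSeqClosed_iff_isClosed]
  intro u p hu hp
  -- The group law moves differentiability from `0` to every `t`. As each `U t` is an isometry, the
  -- derivatives then converge uniformly in `t`, and limit and derivative may be exchanged.
  have h0 : ∀ n t, HasDerivAt (fun t => U t (u n).1) (U t (u n).2) t := by
    intro n t
    have h1 : HasDerivAt (fun s => U (s - t) (u n).1) (u n).2 t := by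
      have h3 := hu n
      simp only [Set.mem_ofPred_eq] at h3
      rw [← sub_self t] at h3
      exact h3.comp_sub_const t t
    have h2 := (U t).toContinuousLinearMap.hasFDerivAt.comp_hasDerivAt t h1
    refine h2.congr_of_eventuallyEq (Eventually.of_forall fun s => ?_)
    simp [← hU]
  have h1 := (Prod.tendsto_iff _ _).1 hp
  have := hasDerivAt_of_tendstoUniformly (l := atTop) (f := fun n t => U t (u n).1)
    (f' := fun n t => U t (u n).2) (g := fun t => U t p.1) (g' := fun t => U t p.2) ?_
    (Eventually.of_forall h0) (fun t => ((U t).continuous.tendsto _).comp h1.1) 0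
  · have h00 : U 0 p.2 = p.2 := by
      apply (U 0).injective
      rw [← hU, add_zero]
    rwa [h00] at this
  · rw [Metric.tendstoUniformly_iff]
    intro ε hε
    filter_upwards [Metric.tendsto_nhds.1 h1.2 ε hε] with n hn t
    rw [(U t).dist_map, dist_comm]
    exact hn

end Abstract

end

/-! ### Pointwise algebra of the metric and of the coefficient `√|g| g⁻¹`. -/

section

variable {d : ℕ}

/-- The coefficient `√(1 + |v|²)(I + v ⊗ v)⁻¹`, as a bilinear form. -/
def coeffForm (v u w : E d) : ℝ :=
  √(1 + ‖v‖ ^ 2) * (inner ℝ u w - inner ℝ v u * inner ℝ v w / (1 + ‖v‖ ^ 2))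

theorem inner_eq_dotProduct (u v : E d) : inner ℝ u v = u.ofLp ⬝ᵥ v.ofLp := by
  simp [PiLp.inner_apply, dotProduct, mul_comm]

theorem det_metric (x : E d) (h : Surf d) : (metric x h).det = 1 + ‖gradient h x‖ ^ 2 := by
  rw [metric, vecMulVec_eq Unit, det_one_add_replicateCol_mul_replicateRow,
    ← real_inner_self_eq_norm_sq, inner_eq_dotProduct]

theorem areaAt_eq (x : E d) (h : Surf d) : areaAt x h = √(1 + ‖gradient h x‖ ^ 2) := by
  rw [areaAt, det_metric]

/-- Sherman-Morrison for a rank-one perturbation of the identity. -/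
theorem one_add_vecMulVec_inv (v : E d) :
    (1 + vecMulVec v.ofLp v.ofLp)⁻¹ = 1 - (1 + ‖v‖ ^ 2)⁻¹ • vecMulVec v.ofLp v.ofLp := by
  have h0 : (1 + ‖v‖ ^ 2) ≠ 0 := by positivity
  have h1 : v.ofLp ⬝ᵥ v.ofLp = ‖v‖ ^ 2 := by
    rw [← real_inner_self_eq_norm_sq, inner_eq_dotProduct]
  refine inv_eq_right_inv ?_
  rw [Matrix.mul_sub, Matrix.mul_smul, add_mul, add_mul, vecMulVec_mul_vecMulVec, h1]
  ext i j
  simp only [mul_one, one_mul, Matrix.sub_apply, Matrix.add_apply, Matrix.smul_apply, vecMulVec_apply, Pi.smul_apply,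
    smul_eq_mul]
  field_simp
  ring

theorem metric_inv (x : E d) (h : Surf d) :
    (metric x h)⁻¹ = 1 - (1 + ‖gradient h x‖ ^ 2)⁻¹ •
      vecMulVec (gradient h x).ofLp (gradient h x).ofLp :=
  one_add_vecMulVec_inv _

theorem form_metric_inv (x : E d) (h : Surf d) (u w : E d) :
    form (metric x h)⁻¹ u w * areaAt x h = coeffForm (gradient h x) u w := by
  rw [form, metric_inv, areaAt_eq, coeffForm, sub_mulVec, smul_mulVec, vecMulVec_mulVec,
    inner_eq_dotProduct, inner_eq_dotProduct, inner_eq_dotProduct,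
    dotProduct_comm _ u.ofLp]
  simp [dotProduct_sub, dotProduct_smul]
  ring

theorem areaAt_mul_metric_inv (x : E d) (h : Surf d) (j k : Fin d) :
    areaAt x h * (metric x h)⁻¹ j k =
      coeffForm (gradient h x) (EuclideanSpace.single j 1) (EuclideanSpace.single k 1) := by
  rw [← form_metric_inv, mul_comm]
  simp [form]

theorem coeffForm_comm (v u w : E d) : coeffForm v u w = coeffForm v w u := by
  rw [coeffForm, coeffForm, real_inner_comm w u, mul_comm (inner ℝ v u)]

theorem coeffForm_add_left (v u u' w : E d) :
    coeffForm v (u + u') w = coeffForm v u w + coeffForm v u' w := by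
  simp only [coeffForm, inner_add_left, inner_add_right]; ring

theorem coeffForm_smul_left (v u w : E d) (c : ℝ) :
    coeffForm v (c • u) w = c * coeffForm v u w := by
  simp only [coeffForm, real_inner_smul_left, real_inner_smul_right]; ring

theorem coeffForm_add_right (v u w w' : E d) :
    coeffForm v u (w + w') = coeffForm v u w + coeffForm v u w' := by
  simp only [coeffForm, inner_add_right]; ring

theorem coeffForm_smul_right (v u w : E d) (c : ℝ) :
    coeffForm v u (c • w) = c * coeffForm v u w := by
  simp only [coeffForm, real_inner_smul_right]; ring

theorem coeffForm_sum_left {ι : Type*} (s : Finset ι) (v : E d) (u : ι → E d) (w : E d) :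
    coeffForm v (∑ i ∈ s, u i) w = ∑ i ∈ s, coeffForm v (u i) w := by
  simp only [coeffForm, sum_inner, inner_sum, Finset.sum_mul, Finset.sum_div]
  rw [← Finset.sum_sub_distrib, Finset.mul_sum]

theorem abs_coeffForm_le (v u w : E d) :
    |coeffForm v u w| ≤ 2 * √(1 + ‖v‖ ^ 2) * (‖u‖ * ‖w‖) := by
  have h0 : (0:ℝ) < 1 + ‖v‖ ^ 2 := by positivity
  have h1 := abs_real_inner_le_norm u w
  have h2 : |inner ℝ v u * inner ℝ v w / (1 + ‖v‖ ^ 2)| ≤ ‖u‖ * ‖w‖ := by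
    rw [abs_div, abs_of_pos h0, div_le_iff₀ h0, abs_mul]
    calc _ ≤ (‖v‖ * ‖u‖) * (‖v‖ * ‖w‖) := by
          gcongr <;> apply abs_real_inner_le_norm
      _ ≤ _ := by nlinarith [mul_nonneg (norm_nonneg u) (norm_nonneg w)]
  rw [coeffForm, abs_mul, abs_of_nonneg (Real.sqrt_nonneg _), mul_comm 2, mul_assoc]
  gcongr
  exact (abs_sub _ _).trans (by linarith)

/-- By Cauchy-Schwarz the quotient of the form by `‖u‖²` is least along `v`, where it equals
`1/√|g|`. This is the ellipticity behind all coercivity. -/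
theorem norm_sq_div_le_coeffForm (v u : E d) :
    ‖u‖ ^ 2 / √(1 + ‖v‖ ^ 2) ≤ coeffForm v u u := by
  have h0 : (0:ℝ) < 1 + ‖v‖ ^ 2 := by positivity
  have h1 : |inner ℝ v u| ≤ ‖v‖ * ‖u‖ := abs_real_inner_le_norm v u
  have h2 : inner ℝ v u * inner ℝ v u ≤ ‖v‖ ^ 2 * ‖u‖ ^ 2 := by
    rw [← abs_mul_abs_self, ← mul_pow, sq]
    gcongr
  have h3 : ‖u‖ ^ 2 / (1 + ‖v‖ ^ 2) ≤
      inner ℝ u u - inner ℝ v u * inner ℝ v u / (1 + ‖v‖ ^ 2) := by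
    rw [real_inner_self_eq_norm_sq, div_le_iff₀ h0, sub_mul, div_mul_cancel₀ _ h0.ne']
    linarith
  calc _ = √(1 + ‖v‖ ^ 2) * (‖u‖ ^ 2 / (1 + ‖v‖ ^ 2)) := by
        nth_rewrite 3 [← Real.sq_sqrt h0.le]
        have : √(1 + ‖v‖ ^ 2) ≠ 0 := (Real.sqrt_pos.2 h0).ne'
        field_simp
    _ ≤ _ := by rw [coeffForm]; gcongr

theorem coeffForm_self_le (v u : E d) : coeffForm v u u ≤ ‖u‖ ^ 2 * √(1 + ‖v‖ ^ 2) := by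
  rw [coeffForm, mul_comm, real_inner_self_eq_norm_sq]
  gcongr
  have : 0 ≤ inner ℝ v u * inner ℝ v u / (1 + ‖v‖ ^ 2) :=
    div_nonneg (mul_self_nonneg _) (by positivity)
  linarith

theorem coeffForm_self_nonneg (v u : E d) : 0 ≤ coeffForm v u u :=
  le_trans (by positivity) (norm_sq_div_le_coeffForm v u)

/-- Legendre duality between `√|g| g⁻¹` and `g / √|g|`. -/
theorem two_inner_sub_le_coeffForm (v u p : E d) :
    2 * inner ℝ p u - (‖p‖ ^ 2 + inner ℝ v p ^ 2) / √(1 + ‖v‖ ^ 2) ≤ coeffForm v u u := by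
  have h0 : (0 : ℝ) < 1 + ‖v‖ ^ 2 := by positivity
  have hs : 0 < √(1 + ‖v‖ ^ 2) := Real.sqrt_pos.2 h0
  have hs2 : 1 + ‖v‖ ^ 2 = √(1 + ‖v‖ ^ 2) ^ 2 := (Real.sq_sqrt h0.le).symm
  -- nonnegativity at `u - √|g|⁻¹ g p`
  have key := coeffForm_self_nonneg v (u - (√(1 + ‖v‖ ^ 2))⁻¹ • (p + inner ℝ v p • v))
  have hvv : inner ℝ v v = ‖v‖ ^ 2 := real_inner_self_eq_norm_sq v
  have hpp : inner ℝ p p = ‖p‖ ^ 2 := real_inner_self_eq_norm_sq p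
  rw [coeffForm] at key ⊢
  simp only [inner_sub_left, inner_sub_right, inner_add_left, inner_add_right,
    real_inner_smul_left, real_inner_smul_right, real_inner_comm v p, real_inner_comm p u,
    real_inner_comm v u, hvv, hpp] at key ⊢
  generalize √(1 + ‖v‖ ^ 2) = s at *
  rw [hs2] at key ⊢
  have hN : ‖v‖ ^ 2 = s ^ 2 - 1 := by linarith
  rw [hN] at key
  rw [← sub_nonneg]
  -- The gap in the duality inequality is exactly the form at the vector chosen above; after `‖v‖² =
  -- s² - 1` this is a rational identity in `s`.
  convert key using 1
  field_simp
  ring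

theorem continuous_coeffForm : Continuous fun p : E d × E d × E d => coeffForm p.1 p.2.1 p.2.2 := by
  have : ∀ p : E d × E d × E d, 1 + ‖p.1‖ ^ 2 ≠ 0 := fun p => by positivity
  unfold coeffForm
  fun_prop (disch := assumption)

theorem contDiff_coeffForm (u w : E d) : ContDiff ℝ 1 fun v : E d => coeffForm v u w := by
  have h0 : ∀ v : E d, 1 + ‖v‖ ^ 2 ≠ 0 := fun p => by positivity
  have h1 : ContDiff ℝ 1 fun v : E d => 1 + ‖v‖ ^ 2 := contDiff_const.add (contDiff_norm_sq ℝ)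
  exact (h1.sqrt h0).mul (contDiff_const.sub
    (((contDiff_id.inner ℝ contDiff_const).mul (contDiff_id.inner ℝ contDiff_const)).div h1 h0))

end

/-! ### Regularity of the gradient, the flux and the drift under translation. -/

section

variable {d : ℕ}

theorem continuous_jet (k : Fin 4) : Continuous fun h : Surf d => jet h k :=
  (continuous_apply k).comp (continuous_induced_dom (f := jet))

theorem continuous_shift (x : E d) : Continuous (shift x : Surf d → Surf d) := by
  refine continuous_induced_rng.2 (continuous_pi fun k => ?_)
  have : (fun h : Surf d => jet (shift x h) k) =
      fun h : Surf d => (jet h k).comp ⟨fun y => y + x, by fun_prop⟩ := by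
    funext h
    ext1 y
    exact iteratedFDeriv_comp_add_right k x y
  change Continuous fun h : Surf d => jet (shift x h) k
  rw [this]
  exact (ContinuousMap.continuous_precomp _).comp (continuous_jet k)

theorem Stationary.measurePreserving {P : Measure (Surf d)} (hA : Stationary P) (x : E d) :
    MeasurePreserving (shift x) P P :=
  ⟨(continuous_shift x).measurable, Measure.ext fun B hB => by
    rw [Measure.map_apply (continuous_shift x).measurable hB, hA B hB x]⟩

theorem shift_shift (x y : E d) (h : Surf d) : shift x (shift y h) = shift (x + y) h :=
  Subtype.ext (funext fun z => congrArg h (add_assoc z x y))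

theorem gradient_shift (x y : E d) (h : Surf d) :
    gradient (shift x h) y = gradient h (y + x) :=
  congrArg _ (fderiv_comp_add_right x)

theorem gradient_apply (h : E d → ℝ) (x : E d) (i : Fin d) :
    gradient h x i = fderiv ℝ h x (EuclideanSpace.single i 1) := by
  rw [← InnerProductSpace.toDual_symm_apply (𝕜 := ℝ) (y := fderiv ℝ h x),
    EuclideanSpace.inner_single_right]
  simp [gradient]

theorem continuous_gradient (x : E d) : Continuous fun h : Surf d => gradient h x := by
  have h1 : ∀ i, Continuous fun h : Surf d => gradient h x i := by
    intro i
    have h2 : (fun h : Surf d => gradient h x i) =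
        fun h : Surf d => jet h 1 x (fun _ : Fin 1 => EuclideanSpace.single i (1 : ℝ)) := by
      funext h
      rw [gradient_apply]
      exact (iteratedFDeriv_one_apply (𝕜 := ℝ) (f := (h : E d → ℝ)) (x := x)
        (fun _ : Fin 1 => EuclideanSpace.single i (1 : ℝ))).symm
    rw [h2]
    have h3 : Continuous fun h : Surf d => jet h 1 x :=
      (continuous_eval_const x).comp (continuous_jet 1)
    exact (continuous_eval_const (F := E d [×1]→L[ℝ] ℝ) _).comp h3
  exact (PiLp.continuous_toLp 2 _).comp (continuous_pi h1)

theorem contDiff_gradient (h : Surf d) : ContDiff ℝ 1 fun x => gradient h x :=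
  (InnerProductSpace.toDual ℝ (E d)).symm.contDiff.comp
    ((h.2.of_le (by norm_num : (2 : WithTop ℕ∞) ≤ 3)).fderiv_right (m := 1) (by norm_num))

theorem norm_gradient_sub_le {K : ℝ} (h : Surf d) (hK : ∀ x, ‖iteratedFDeriv ℝ 2 h x‖ ≤ K)
    (x y : E d) : ‖gradient h x - gradient h y‖ ≤ K * ‖x - y‖ := by
  have h1 : ContDiff ℝ 1 (fderiv ℝ h) :=
    (h.2.of_le (by norm_num : (2 : WithTop ℕ∞) ≤ 3)).fderiv_right (by norm_num)
  have h2 : ‖gradient h x - gradient h y‖ = ‖fderiv ℝ h x - fderiv ℝ h y‖ := by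
    rw [gradient, gradient, ← map_sub, LinearIsometryEquiv.norm_map]
  rw [h2]
  refine convex_univ.norm_image_sub_le_of_norm_fderiv_le (𝕜 := ℝ)
    (fun z _ => (h1.differentiable (by norm_num)) z) (fun z _ => ?_) (Set.mem_univ y)
    (Set.mem_univ x)
  rw [← norm_iteratedFDeriv_one, norm_iteratedFDeriv_fderiv]
  exact hK z

/-- The component `u · √|g| g⁻¹ w` of the flux at the point `x`. -/
def flux (u w : E d) (h : Surf d) (x : E d) : ℝ := coeffForm (gradient h x) u w

theorem flux_shift (u w : E d) (h : Surf d) (x y : E d) :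
    flux u w (shift x h) y = flux u w h (y + x) := by
  rw [flux, gradient_shift, flux]

theorem differentiable_flux (u w : E d) (h : Surf d) : Differentiable ℝ (flux u w h) :=
  ((contDiff_coeffForm u w).comp (contDiff_gradient h)).differentiable (by norm_num)

theorem continuous_flux (u w x : E d) : Continuous fun h : Surf d => flux u w h x :=
  (contDiff_coeffForm u w).continuous.comp (continuous_gradient x)

/-- The coefficient is `C^1` in the gradient, hence Lipschitz on the compact ball of radius `K`, and
the Hessian bound makes the gradient Lipschitz in space. One constant serves all admissible
surfaces, which later allows dominated differentiation. -/
theorem exists_lipschitz_flux (u w : E d) (K : ℝ) : ∃ C : ℝ, 0 ≤ C ∧ ∀ h : Surf d,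
    (∀ x, ‖gradient h x‖ + ‖iteratedFDeriv ℝ 2 h x‖ ≤ K) →
      ∀ x y, |flux u w h x - flux u w h y| ≤ C * ‖x - y‖ := by
  obtain ⟨C, hC⟩ := (contDiff_coeffForm u w).locallyLipschitz.locallyLipschitzOn
    (s := Metric.closedBall 0 K) |>.exists_lipschitzOnWith_of_compact (isCompact_closedBall 0 K)
  refine ⟨C * |K|, by positivity, fun h hK x y => ?_⟩
  have hg : ∀ z, ‖gradient h z‖ ≤ K := fun z =>
    le_trans (le_add_of_nonneg_right (norm_nonneg _)) (hK z)
  have hg2 : ∀ z, ‖iteratedFDeriv ℝ 2 h z‖ ≤ K := fun z =>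
    le_trans (le_add_of_nonneg_left (norm_nonneg _)) (hK z)
  have h1 := hC.norm_sub_le (mem_closedBall_zero_iff.2 (hg x)) (mem_closedBall_zero_iff.2 (hg y))
  rw [mul_assoc]
  refine h1.trans ?_
  gcongr
  exact (norm_gradient_sub_le h hg2 x y).trans (by gcongr; exact le_abs_self K)

theorem eq_sum_smul_single (e : E d) : e = ∑ k, e k • EuclideanSpace.single k (1 : ℝ) := by
  ext i
  simp [Finset.sum_apply, Pi.single_apply]

/-- Puts the drift in divergence form: by linearity in `e`, the double sum is the divergence of the
vector field `√|g| g⁻¹ e`. -/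
theorem drift_eq (e : E d) (h : Surf d) :
    drift e h = (area h)⁻¹ * ∑ j, fderiv ℝ (flux (EuclideanSpace.single j 1) e h) 0
      (EuclideanSpace.single j 1) := by
  rw [drift, Finset.sum_comm]
  congr 1
  refine Finset.sum_congr rfl fun j _ => ?_
  have h1 : flux (EuclideanSpace.single j 1) e h =
      fun x => ∑ k, e k * flux (EuclideanSpace.single j 1) (EuclideanSpace.single k 1) h x := by
    funext x
    conv_lhs => rw [eq_sum_smul_single e]
    simp only [flux]
    rw [coeffForm_comm, coeffForm_sum_left]
    exact Finset.sum_congr rfl fun k _ => by rw [coeffForm_smul_left, coeffForm_comm]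
  have h2 := fun k => differentiable_flux (EuclideanSpace.single j 1) (EuclideanSpace.single k 1) h
  rw [h1, fderiv_fun_sum (fun k _ => ((h2 k).const_mul _) 0)]
  simp only [areaAt_mul_metric_inv]
  rw [_root_.sum_apply]
  refine Finset.sum_congr rfl fun k _ => ?_
  rw [fderiv_const_mul (h2 k 0)]
  rw [_root_.smul_apply, smul_eq_mul, mul_comm]
  rfl

theorem hasDerivAt_flux (u w v : E d) (h : Surf d) :
    HasDerivAt (fun t : ℝ => flux u w h (t • v)) (fderiv ℝ (flux u w h) 0 v) 0 := by
  have h1 : HasDerivAt (fun t : ℝ => t • v) v 0 := by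
    simpa using (hasDerivAt_id (0 : ℝ)).smul_const v
  have h2 : HasFDerivAt (flux u w h) (fderiv ℝ (flux u w h) 0) ((0 : ℝ) • v) := by
    rw [zero_smul]; exact (differentiable_flux u w h 0).hasFDerivAt
  exact h2.comp_hasDerivAt 0 h1

theorem abs_fderiv_flux_le {u w : E d} {h : Surf d} {C : ℝ} (hC0 : 0 ≤ C)
    (hC : ∀ x y, |flux u w h x - flux u w h y| ≤ C * ‖x - y‖) (v : E d) :
    |fderiv ℝ (flux u w h) 0 v| ≤ C * ‖v‖ := by
  refine ((fderiv ℝ (flux u w h) 0).le_opNorm v).trans ?_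
  gcongr
  exact norm_fderiv_le_of_lip' ℝ hC0 (Eventually.of_forall fun x => hC x 0)

/-- The derivative is a pointwise limit of difference quotients with steps `1/(n+1)`, each
continuous on the sample space. -/
theorem measurable_fderiv_flux (u w v : E d) :
    Measurable fun h : Surf d => fderiv ℝ (flux u w h) 0 v := by
  refine measurable_of_tendsto_metrizable (f := fun (n : ℕ) (h : Surf d) =>
    ((1 : ℝ) / (n + 1))⁻¹ • (flux u w h ((0 + 1 / ((n : ℝ) + 1)) • v) - flux u w h ((0 : ℝ) • v)))
    (fun n => ?_) ?_
  · exact (((continuous_flux u w _).sub (continuous_flux u w _)).const_smul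
      ((1 : ℝ) / (n + 1))⁻¹).measurable
  · rw [tendsto_pi_nhds]
    intro h
    refine (hasDerivAt_iff_tendsto_slope_zero.1 (hasDerivAt_flux u w v h)).comp
      (tendsto_nhdsWithin_iff.2 ⟨tendsto_one_div_add_atTop_nhds_zero_nat, ?_⟩)
    exact Eventually.of_forall fun n => by simp; positivity

theorem continuous_area : Continuous fun h : Surf d => area h := by
  simp only [area, areaAt_eq]
  have := continuous_gradient (0 : E d)
  fun_prop

end

/-! ### Translations, gradients and potential fields in `L²(P)`. -/

section

variable {d : ℕ}

/-- A bounded measurable field of bilinear forms defines a bounded bilinear form on `L²`. -/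
theorem exists_bilin_eq_integral {Ω F : Type*} [MeasurableSpace Ω] {μ : Measure Ω}
    [NormedAddCommGroup F] [InnerProductSpace ℝ F] (B : Ω → F → F → ℝ) (C : ℝ)
    (hC : ∀ᵐ h ∂μ, ∀ u w, |B h u w| ≤ C * (‖u‖ * ‖w‖))
    (hm : ∀ G Γ : Ω → F, AEStronglyMeasurable G μ → AEStronglyMeasurable Γ μ →
      AEStronglyMeasurable (fun h => B h (G h) (Γ h)) μ)
    (hal : ∀ h u u' w, B h (u + u') w = B h u w + B h u' w)
    (hsl : ∀ h u w, ∀ c : ℝ, B h (c • u) w = c * B h u w)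
    (har : ∀ h u w w', B h u (w + w') = B h u w + B h u w')
    (hsr : ∀ h u w, ∀ c : ℝ, B h u (c • w) = c * B h u w) :
    ∃ a : Lp F 2 μ →L[ℝ] Lp F 2 μ →L[ℝ] ℝ,
      (∀ G Γ : Lp F 2 μ, Integrable (fun h => B h (G h) (Γ h)) μ) ∧
      ∀ G Γ : Lp F 2 μ, a G Γ = ∫ h, B h (G h) (Γ h) ∂μ := by
  have hint : ∀ G Γ : Lp F 2 μ, Integrable (fun h => ‖G h‖ * ‖Γ h‖) μ := fun G Γ =>
    (Lp.memLp G).norm.integrable_mul (Lp.memLp Γ).norm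
  have hi : ∀ G Γ : Lp F 2 μ, Integrable (fun h => B h (G h) (Γ h)) μ := fun G Γ =>
    ((hint G Γ).const_mul C).mono' (hm _ _ (Lp.aestronglyMeasurable G) (Lp.aestronglyMeasurable Γ))
      (by filter_upwards [hC] with h hh using hh _ _)
  have hhol : ∀ G Γ : Lp F 2 μ, ∫ h, ‖G h‖ * ‖Γ h‖ ∂μ ≤ ‖G‖ * ‖Γ‖ := by
    intro G Γ
    have h1 := real_inner_le_norm ((Lp.memLp G).norm.toLp _) ((Lp.memLp Γ).norm.toLp _)
    rw [L2.inner_def, Lp.norm_toLp, Lp.norm_toLp, eLpNorm_norm, eLpNorm_norm] at h1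
    refine le_trans (le_of_eq (integral_congr_ae ?_)) h1
    filter_upwards [(Lp.memLp G).norm.coeFn_toLp, (Lp.memLp Γ).norm.coeFn_toLp] with h e1 e2
    rw [e1, e2]
    simp [mul_comm]
  refine ⟨LinearMap.mkContinuous₂ (LinearMap.mk₂ ℝ
    (fun G Γ : Lp F 2 μ => ∫ h, B h (G h) (Γ h) ∂μ) ?_ ?_ ?_ ?_) |C| ?_, hi, fun G Γ => rfl⟩
  · intro G G' Γ
    rw [← integral_add (hi _ _) (hi _ _)]
    refine integral_congr_ae ?_
    filter_upwards [Lp.coeFn_add G G'] with h e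
    rw [e, Pi.add_apply, hal]
  · intro c G Γ
    rw [smul_eq_mul, ← integral_const_mul]
    refine integral_congr_ae ?_
    filter_upwards [Lp.coeFn_smul c G] with h e
    rw [e, Pi.smul_apply, hsl]
  · intro G Γ Γ'
    rw [← integral_add (hi _ _) (hi _ _)]
    refine integral_congr_ae ?_
    filter_upwards [Lp.coeFn_add Γ Γ'] with h e
    rw [e, Pi.add_apply, har]
  · intro c G Γ
    rw [smul_eq_mul, ← integral_const_mul]
    refine integral_congr_ae ?_
    filter_upwards [Lp.coeFn_smul c Γ] with h e
    rw [e, Pi.smul_apply, hsr]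
  · intro G Γ
    rw [LinearMap.mk₂_apply]
    calc ‖∫ h, B h (G h) (Γ h) ∂μ‖ ≤ ∫ h, |C| * (‖G h‖ * ‖Γ h‖) ∂μ := by
          refine norm_integral_le_of_norm_le ((hint G Γ).const_mul _) ?_
          filter_upwards [hC] with h hh
          refine (hh _ _).trans ?_
          gcongr
          exact le_abs_self C
      _ ≤ |C| * ‖G‖ * ‖Γ‖ := by
          rw [integral_const_mul, mul_assoc]
          gcongr
          exact hhol G Γ

variable {P : Measure (Surf d)}

/-- Translation by `t eᵢ` on `L²(P)`. -/
def transl (hA : Stationary P) (i : Fin d) (t : ℝ) : Lp ℝ 2 P →ₗᵢ[ℝ] Lp ℝ 2 P :=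
  Lp.compMeasurePreservingₗᵢ ℝ (shift (EuclideanSpace.single i t)) (hA.measurePreserving _)

theorem coeFn_transl (hA : Stationary P) (i : Fin d) (t : ℝ) (V : Lp ℝ 2 P) :
    transl hA i t V =ᵐ[P] fun h => V (shift (EuclideanSpace.single i t) h) :=
  Lp.coeFn_compMeasurePreserving V (hA.measurePreserving _)

theorem transl_add (hA : Stationary P) (i : Fin d) (s t : ℝ) (V : Lp ℝ 2 P) :
    transl hA i (s + t) V = transl hA i s (transl hA i t V) := by
  refine Lp.ext ?_
  filter_upwards [coeFn_transl hA i (s + t) V, coeFn_transl hA i s (transl hA i t V),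
    (hA.measurePreserving (EuclideanSpace.single i s)).quasiMeasurePreserving.ae
      (coeFn_transl hA i t V)] with h h1 h2 h3
  rw [h1, h2, h3, shift_shift]
  congr 2
  ext j
  simp only [PiLp.add_apply, PiLp.single_apply]
  split_ifs <;> simp [add_comm]

theorem transl_zero (hA : Stationary P) (i : Fin d) (V : Lp ℝ 2 P) : transl hA i 0 V = V := by
  apply (transl hA i 0).injective
  rw [← transl_add, add_zero]

/-- The translations are unitary, so the adjoint of a shift is the opposite shift. -/
theorem inner_transl (hA : Stationary P) (i : Fin d) (t : ℝ) (V W : Lp ℝ 2 P) :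
    inner ℝ V (transl hA i t W) = inner ℝ (transl hA i (-t) V) W := by
  rw [← (transl hA i t).inner_map_map (transl hA i (-t) V) W, ← transl_add, add_neg_cancel,
    transl_zero]

/-- The `i`-th component of an `L²` vector field. -/
def coord (P : Measure (Surf d)) (i : Fin d) : Lp (E d) 2 P →L[ℝ] Lp ℝ 2 P :=
  (EuclideanSpace.proj i : E d →L[ℝ] ℝ).compLpL 2 P

theorem coeFn_coord (i : Fin d) (G : Lp (E d) 2 P) : coord P i G =ᵐ[P] fun h => G h i :=
  ContinuousLinearMap.coeFn_compLpL _ G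

theorem coord_ext {G Γ : Lp (E d) 2 P} (h : ∀ i, coord P i G = coord P i Γ) : G = Γ := by
  refine Lp.ext ?_
  have h1 : ∀ᵐ ω ∂P, ∀ i, G ω i = Γ ω i := by
    rw [ae_all_iff]
    intro i
    filter_upwards [coeFn_coord i G, coeFn_coord i Γ] with ω e1 e2
    rw [← e1, ← e2, h i]
  filter_upwards [h1] with ω hω
  ext i
  exact hω i

/-- Recasts the difference quotients as differentiability of an orbit in `L²(P)`, so that the
abstract closedness result applies. -/
theorem hasGrad_iff (hA : Stationary P) (V : Lp ℝ 2 P) (G : Lp (E d) 2 P) :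
    HasGrad P V G ↔ ∀ i, HasDerivAt (fun t => transl hA i t V) (coord P i G) 0 := by
  refine forall_congr' fun i => ?_
  rw [hasDerivAt_iff_tendsto_slope_zero, tendsto_iff_edist_tendsto_0]
  refine tendsto_congr fun t => ?_
  rw [Lp.edist_def]
  refine eLpNorm_congr_ae ?_
  rw [transl_zero]
  filter_upwards [coeFn_transl hA i (0 + t) V, coeFn_coord i G,
    Lp.coeFn_smul t⁻¹ (transl hA i (0 + t) V - V), Lp.coeFn_sub (transl hA i (0 + t) V) V]
    with h h1 h2 h3 h4
  rw [Pi.sub_apply, h2, h3, Pi.smul_apply, h4, Pi.sub_apply, h1, zero_add, smul_eq_mul]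

/-- The graph of `𝔻`. -/
def gradGraph (hA : Stationary P) : Submodule ℝ (WithLp 2 (Lp ℝ 2 P × Lp (E d) 2 P)) where
  carrier := {p | HasGrad P p.fst p.snd}
  add_mem' := by
    intro p q hp hq
    rw [Set.mem_ofPred_eq, hasGrad_iff hA] at *
    intro i
    simpa using (hp i).fun_add (hq i)
  zero_mem' := by
    rw [Set.mem_ofPred_eq, hasGrad_iff hA]
    intro i
    simpa using hasDerivAt_const (0 : ℝ) (0 : Lp ℝ 2 P)
  smul_mem' := by
    intro c p hp
    rw [Set.mem_ofPred_eq, hasGrad_iff hA] at *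
    intro i
    simpa using (hp i).fun_const_smul c

theorem mem_gradGraph {hA : Stationary P} {p : WithLp 2 (Lp ℝ 2 P × Lp (E d) 2 P)} :
    p ∈ gradGraph hA ↔ HasGrad P p.fst p.snd := Iff.rfl

theorem isClosed_gradGraph (hA : Stationary P) :
    IsClosed (gradGraph hA : Set (WithLp 2 (Lp ℝ 2 P × Lp (E d) 2 P))) := by
  have h1 : (gradGraph hA : Set (WithLp 2 (Lp ℝ 2 P × Lp (E d) 2 P))) =
      ⋂ i, (fun p => (p.fst, coord P i p.snd)) ⁻¹'
        {p : Lp ℝ 2 P × Lp ℝ 2 P | HasDerivAt (fun t => transl hA i t p.1) p.2 0} := by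
    ext p
    rw [SetLike.mem_coe, mem_gradGraph, hasGrad_iff hA]
    simp
  rw [h1]
  refine isClosed_iInter fun i => (isClosed_hasDerivAt_zero _ (transl_add hA i)).preimage ?_
  exact (WithLp.fstL 2 ℝ _ _).continuous.prodMk
    ((coord P i).continuous.comp (WithLp.sndL 2 ℝ _ _).continuous)

theorem HasGrad.unique (hA : Stationary P) {V : Lp ℝ 2 P} {G Γ : Lp (E d) 2 P}
    (h : HasGrad P V G) (h' : HasGrad P V Γ) : G = Γ := by
  rw [hasGrad_iff hA] at h h'
  exact coord_ext fun i => (h i).unique (h' i)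

/-- `L²_pot(P)` as a closed subspace. -/
def potential (hA : Stationary P) : Submodule ℝ (Lp (E d) 2 P) :=
  ((gradGraph hA).map (WithLp.sndL 2 ℝ (Lp ℝ 2 P) (Lp (E d) 2 P)).toLinearMap).topologicalClosure

theorem coe_potential (hA : Stationary P) : (potential hA : Set (Lp (E d) 2 P)) = L2pot P := by
  rw [potential, Submodule.topologicalClosure_coe, L2pot]
  congr 1
  ext G
  constructor
  · rintro ⟨p, hp, rfl⟩
    exact ⟨p.fst, hp⟩
  · rintro ⟨V, hV⟩
    exact ⟨WithLp.toLp 2 (V, G), hV, rfl⟩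

theorem mem_potential {hA : Stationary P} {G : Lp (E d) 2 P} : G ∈ potential hA ↔ G ∈ L2pot P := by
  rw [← coe_potential hA, SetLike.mem_coe]

theorem isClosed_potential (hA : Stationary P) : IsClosed (potential hA : Set (Lp (E d) 2 P)) :=
  Submodule.isClosed_topologicalClosure _

theorem HasGrad.mem_potential (hA : Stationary P) {V : Lp ℝ 2 P} {G : Lp (E d) 2 P}
    (h : HasGrad P V G) : G ∈ potential hA :=
  RandomSurface.mem_potential.2 (subset_closure ⟨V, h⟩)

/-- Integration by parts against the derivative along the translations. -/
theorem HasGrad.hasDerivAt_inner (hA : Stationary P) {V : Lp ℝ 2 P} {G : Lp (E d) 2 P}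
    (h : HasGrad P V G) (i : Fin d) (F : Lp ℝ 2 P) :
    HasDerivAt (fun t => inner ℝ (transl hA i t F) V) (-inner ℝ F (coord P i G)) 0 := by
  have h1 := (hasGrad_iff hA V G).1 h i
  have h2 : HasDerivAt (fun t => inner ℝ F (transl hA i t V)) (inner ℝ F (coord P i G)) 0 := by
    simpa using (hasDerivAt_const (0 : ℝ) F).inner ℝ h1
  -- Moving the shift from `V` to `F` reverses time; the reflection `t ↦ -t` produces the minus
  -- sign.
  have h3 : HasDerivAt (fun t => inner ℝ F (transl hA i t V)) (inner ℝ F (coord P i G))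
      (-(0 : ℝ)) := by simpa using h2
  have h4 := h3.scomp (0 : ℝ) (hasDerivAt_neg 0)
  simp only [neg_smul, one_smul] at h4
  refine h4.congr_of_eventuallyEq (Eventually.of_forall fun t => ?_)
  simp [inner_transl]

variable [IsProbabilityMeasure P]

theorem inner_const (p : E d) (G : Lp (E d) 2 P) :
    inner ℝ (Lp.const 2 P p) G = ∫ h, inner ℝ p (G h) ∂P := by
  rw [L2.inner_def]
  refine integral_congr_ae ?_
  filter_upwards [Lp.coeFn_const 2 P p] with h e
  rw [e]
  rfl

/-- Constants are invariant under translation, so integrating by parts against `1` gives zero. -/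
theorem HasGrad.integral_eq_zero (hA : Stationary P) {V : Lp ℝ 2 P} {G : Lp (E d) 2 P}
    (h : HasGrad P V G) (i : Fin d) : ∫ ω, G ω i ∂P = 0 := by
  have h1 := h.hasDerivAt_inner hA i (Lp.const 2 P 1)
  have h2 : ∀ t, transl hA i t (Lp.const 2 P (1 : ℝ)) = Lp.const 2 P 1 := by
    intro t
    refine Lp.ext ?_
    filter_upwards [coeFn_transl hA i t (Lp.const 2 P 1), Lp.coeFn_const 2 P (1 : ℝ),
      (hA.measurePreserving (EuclideanSpace.single i t)).quasiMeasurePreserving.ae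
        (Lp.coeFn_const 2 P (1 : ℝ))] with ω e1 e2 e3
    rw [e1, e2, e3]
    rfl
  simp only [h2] at h1
  have h3 := h1.unique (hasDerivAt_const _ _)
  rw [neg_eq_zero, L2.inner_def] at h3
  rw [← h3]
  refine integral_congr_ae ?_
  filter_upwards [coeFn_coord i G, Lp.coeFn_const 2 P (1 : ℝ)] with ω e1 e2
  rw [e1, e2]
  simp

theorem integrable_of_Lp {F : Type*} [NormedAddCommGroup F] (G : Lp F 2 P) : Integrable G P :=
  (Lp.memLp G).integrable one_le_two

/-- Gradients have mean zero, and pairing with a constant field is continuous, so this passes to the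
closure. -/
theorem integral_inner_potential (hA : Stationary P) {G : Lp (E d) 2 P} (hG : G ∈ potential hA)
    (p : E d) : ∫ h, inner ℝ p (G h) ∂P = 0 := by
  rw [← inner_const]
  have h1 : L2pot P ⊆ {G | inner ℝ (Lp.const 2 P p) G = 0} := by
    refine closure_minimal ?_ (isClosed_eq (by fun_prop) continuous_const)
    rintro Γ ⟨V, hV⟩
    rw [Set.mem_ofPred_eq, inner_const]
    have h2 := integrable_of_Lp Γ
    have h3 : ∀ i, Integrable (fun h => Γ h i) P := fun i =>
      (EuclideanSpace.proj i : E d →L[ℝ] ℝ).integrable_comp h2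
    simp only [PiLp.inner_apply, RCLike.inner_apply, conj_trivial]
    rw [integral_finsetSum _ fun i _ => (h3 i).mul_const _]
    refine Finset.sum_eq_zero fun i _ => ?_
    rw [integral_mul_const, hV.integral_eq_zero hA, zero_mul]
  exact h1 (mem_potential.1 hG)

end

/-! ### The Dirichlet form, the weight `π` and integration by parts for the flux. -/

section

variable {d : ℕ}

theorem area_eq (h : Surf d) : area h = √(1 + ‖gradient h 0‖ ^ 2) := areaAt_eq 0 h

theorem one_le_area (h : Surf d) : 1 ≤ area h := by
  rw [area_eq, Real.one_le_sqrt]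
  linarith [sq_nonneg ‖gradient h 0‖]

theorem area_pos (h : Surf d) : 0 < area h := one_pos.trans_le (one_le_area h)

variable {P : Measure (Surf d)}

theorem BoundedDerivatives.exists_area_le (hD : BoundedDerivatives P) :
    ∃ A : ℝ, 0 < A ∧ ∀ᵐ h ∂P, area h ≤ A := by
  obtain ⟨K, hK, h1⟩ := hD
  refine ⟨√(1 + K ^ 2), by positivity, ?_⟩
  filter_upwards [h1] with h hh
  rw [area_eq]
  gcongr
  exact (le_add_of_nonneg_right (norm_nonneg _)).trans (hh 0)

theorem dirichletForm_eq (G Γ : Lp (E d) 2 P) :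
    dirichletForm P G Γ = (Z P)⁻¹ * ∫ h, coeffForm (gradient h 0) (G h) (Γ h) ∂P := by
  rw [dirichletForm]
  congr 2
  funext h
  exact form_metric_inv 0 h (G h) (Γ h)

theorem dirichletForm_comm (G Γ : Lp (E d) 2 P) :
    dirichletForm P G Γ = dirichletForm P Γ G := by
  simp only [dirichletForm_eq, coeffForm_comm _ (G _)]

theorem aestronglyMeasurable_coeffForm {G Γ : Surf d → E d} (hG : AEStronglyMeasurable G P)
    (hΓ : AEStronglyMeasurable Γ P) :
    AEStronglyMeasurable (fun h : Surf d => coeffForm (gradient h 0) (G h) (Γ h)) P := by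
  have h0 : AEStronglyMeasurable (fun h : Surf d => gradient h 0) P :=
    (continuous_gradient 0).measurable.aestronglyMeasurable
  have h1 : AEStronglyMeasurable (fun h : Surf d => (gradient h 0, G h, Γ h)) P :=
    h0.prodMk (hG.prodMk hΓ)
  have h2 := continuous_coeffForm.comp_aestronglyMeasurable h1
  dsimp only at h2
  exact h2

theorem BoundedDerivatives.exists_abs_coeffForm_le (hD : BoundedDerivatives P) :
    ∃ C : ℝ, 0 < C ∧ ∀ᵐ h : Surf d ∂P, ∀ u w : E d, |coeffForm (gradient h 0) u w| ≤ C * (‖u‖ * ‖w‖) := by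
  obtain ⟨A, hA0, hA⟩ := hD.exists_area_le
  refine ⟨2 * A, by positivity, ?_⟩
  filter_upwards [hA] with h hh u w
  refine (abs_coeffForm_le _ u w).trans ?_
  rw [← area_eq]
  gcongr

variable [IsProbabilityMeasure P]

theorem BoundedDerivatives.integrable_area (hD : BoundedDerivatives P) :
    Integrable (fun h => area h) P := by
  obtain ⟨A, -, hA⟩ := hD.exists_area_le
  refine Integrable.of_bound continuous_area.measurable.aestronglyMeasurable A ?_
  filter_upwards [hA] with h hh
  rwa [Real.norm_of_nonneg (area_pos h).le]

theorem BoundedDerivatives.one_le_Z (hD : BoundedDerivatives P) : 1 ≤ Z P := by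
  have := integral_mono (integrable_const (1 : ℝ)) hD.integrable_area one_le_area
  simpa [Z] using this

theorem BoundedDerivatives.Z_pos (hD : BoundedDerivatives P) : 0 < Z P :=
  one_pos.trans_le hD.one_le_Z

theorem BoundedDerivatives.dirichletForm_self_nonneg (hD : BoundedDerivatives P)
    (G : Lp (E d) 2 P) : 0 ≤ dirichletForm P G G := by
  rw [dirichletForm_eq]
  exact mul_nonneg (inv_nonneg.2 hD.Z_pos.le) (integral_nonneg fun h => coeffForm_self_nonneg _ _)

omit [IsProbabilityMeasure P] in
theorem norm_sq_eq_integral {F : Type*} [NormedAddCommGroup F] [InnerProductSpace ℝ F]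
    (G : Lp F 2 P) : ‖G‖ * ‖G‖ = ∫ h, ‖G h‖ ^ 2 ∂P := by
  rw [← real_inner_self_eq_norm_mul_norm, L2.inner_def]
  simp only [real_inner_self_eq_norm_sq]

omit [IsProbabilityMeasure P] in
theorem integrable_norm_sq {F : Type*} [NormedAddCommGroup F] (G : Lp F 2 P) :
    Integrable (fun h => ‖G h‖ ^ 2) P :=
  (memLp_two_iff_integrable_sq_norm (Lp.aestronglyMeasurable G)).1 (Lp.memLp G)

/-- The area bound `A` gives boundedness, and ellipticity gives the coercivity constant `1/(Z A)`.
The completed energy space is thus `L²(P)^d` itself with an equivalent norm. -/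
theorem BoundedDerivatives.exists_bilin (hD : BoundedDerivatives P) :
    ∃ a : Lp (E d) 2 P →L[ℝ] Lp (E d) 2 P →L[ℝ] ℝ,
      (∀ G Γ : Lp (E d) 2 P, Integrable (fun h : Surf d => coeffForm (gradient h 0) (G h) (Γ h)) P) ∧
      (∀ G Γ, a G Γ = dirichletForm P G Γ) ∧ IsCoercive a := by
  obtain ⟨C, -, hC⟩ := hD.exists_abs_coeffForm_le
  obtain ⟨A, hA0, hA⟩ := hD.exists_area_le
  obtain ⟨a, hi, ha⟩ := exists_bilin_eq_integral (μ := P)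
    (fun (h : Surf d) u w => coeffForm (gradient h 0) u w) C hC
    (fun G Γ hG hΓ => aestronglyMeasurable_coeffForm hG hΓ)
    (fun h => coeffForm_add_left _) (fun h => coeffForm_smul_left _)
    (fun h => coeffForm_add_right _) (fun h => coeffForm_smul_right _)
  have hZ := hD.Z_pos
  refine ⟨(Z P)⁻¹ • a, hi, fun G Γ => ?_, (Z P)⁻¹ * A⁻¹, by positivity, fun G => ?_⟩
  · rw [dirichletForm_eq, ← ha]
    rfl
  · change _ ≤ (Z P)⁻¹ * a G G
    rw [mul_assoc, mul_assoc]
    gcongr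
    rw [ha, norm_sq_eq_integral, ← integral_const_mul]
    refine integral_mono_ae ((integrable_norm_sq G).const_mul _) (hi G G) ?_
    filter_upwards [hA] with h hh
    refine le_trans ?_ (norm_sq_div_le_coeffForm _ _)
    rw [← area_eq, div_eq_inv_mul]
    have := area_pos h
    gcongr

theorem BoundedDerivatives.integral_piMeasure (hD : BoundedDerivatives P) (f : Surf d → ℝ) :
    ∫ h, f h ∂(piMeasure P) = ∫ h, area h / Z P * f h ∂P := by
  rw [piMeasure, integral_withDensity_eq_integral_toReal_smul₀]
  · refine integral_congr_ae (Eventually.of_forall fun h => ?_)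
    simp only [smul_eq_mul]
    rw [ENNReal.toReal_ofReal (div_nonneg (area_pos h).le hD.Z_pos.le)]
  · exact (continuous_area.measurable.div_const _).ennreal_ofReal.aemeasurable
  · exact Eventually.of_forall fun h => ENNReal.ofReal_lt_top

theorem BoundedDerivatives.exists_pi_bilin (hD : BoundedDerivatives P) :
    ∃ b : Lp ℝ 2 P →L[ℝ] Lp ℝ 2 P →L[ℝ] ℝ,
      (∀ V ψ, b V ψ = ∫ h, V h * ψ h ∂(piMeasure P)) ∧ IsCoercive b := by
  obtain ⟨A, hA0, hA⟩ := hD.exists_area_le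
  have hZ := hD.Z_pos
  have hm : AEStronglyMeasurable (fun h => area h / Z P) P :=
    (continuous_area.measurable.div_const _).aestronglyMeasurable
  obtain ⟨b, hi, hb⟩ := exists_bilin_eq_integral (μ := P) (F := ℝ)
    (fun h u w => area h / Z P * (u * w)) (A / Z P) (by
      filter_upwards [hA] with h hh u w
      rw [abs_mul, abs_mul, abs_of_nonneg (div_nonneg (area_pos h).le hZ.le), Real.norm_eq_abs,
        Real.norm_eq_abs]
      gcongr)
    (fun G Γ hG hΓ => hm.mul (hG.mul hΓ))
    (fun h u u' w => by ring) (fun h u w c => by rw [smul_eq_mul]; ring)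
    (fun h u u' w => by ring) (fun h u w c => by rw [smul_eq_mul]; ring)
  refine ⟨b, fun V ψ => by rw [hb, hD.integral_piMeasure], (Z P)⁻¹, by positivity, fun V => ?_⟩
  rw [hb, mul_assoc, norm_sq_eq_integral, ← integral_const_mul]
  refine integral_mono ((integrable_norm_sq V).const_mul _) (hi V V) fun h => ?_
  dsimp only
  rw [Real.norm_eq_abs, sq_abs, sq, inv_eq_one_div]
  have := one_le_area h
  have := mul_self_nonneg (V h)
  gcongr

theorem BoundedDerivatives.memLp_flux (hD : BoundedDerivatives P) (u w : E d) :
    MemLp (fun h : Surf d => flux u w h 0) 2 P := by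
  obtain ⟨C, -, hC⟩ := hD.exists_abs_coeffForm_le
  refine MemLp.of_bound (continuous_flux u w 0).measurable.aestronglyMeasurable
    (C * (‖u‖ * ‖w‖)) ?_
  filter_upwards [hC] with h hh
  exact hh u w

/-- Integration by parts for the flux. -/
theorem HasGrad.integral_fderiv_flux (hA : Stationary P) (hD : BoundedDerivatives P)
    {V : Lp ℝ 2 P} {G : Lp (E d) 2 P} (hV : HasGrad P V G) (u w : E d) (i : Fin d) :
    Integrable (fun h => fderiv ℝ (flux u w h) 0 (EuclideanSpace.single i 1) * V h) P ∧
    ∫ h, fderiv ℝ (flux u w h) 0 (EuclideanSpace.single i 1) * V h ∂P =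
      - ∫ h, flux u w h 0 * G h i ∂P := by
  obtain ⟨K, -, hK⟩ := id hD
  obtain ⟨C, hC0, hC⟩ := exists_lipschitz_flux u w K
  set F : Lp ℝ 2 P := (hD.memLp_flux u w).toLp _ with hF
  have hFe := (hD.memLp_flux u w).coeFn_toLp
  have hVi := integrable_of_Lp V
  have e0 : ∀ t : ℝ, (EuclideanSpace.single i t : E d) = t • EuclideanSpace.single i (1 : ℝ) := by
    intro t
    ext j
    simp
  have h1 : ∀ t, inner ℝ (transl hA i t F) V =
      ∫ h, flux u w h (t • EuclideanSpace.single i 1) * V h ∂P := by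
    intro t
    rw [L2.inner_def]
    refine integral_congr_ae ?_
    filter_upwards [coeFn_transl hA i t F,
      (hA.measurePreserving (EuclideanSpace.single i t)).quasiMeasurePreserving.ae hFe]
      with h e1 e2
    rw [e1, e2, flux_shift, zero_add, e0]
    simp [mul_comm]
  -- The uniform Lipschitz constant dominates the difference quotients by `C |V|`. Comparing the
  -- derivative under the integral with the one from the adjoint shift gives the formula.
  have h2 := hasDerivAt_integral_of_dominated_loc_of_lip (μ := P) (x₀ := (0 : ℝ))
    (F := fun t h => flux u w h (t • EuclideanSpace.single i 1) * V h)
    (F' := fun h => fderiv ℝ (flux u w h) 0 (EuclideanSpace.single i 1) * V h)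
    (s := Set.univ) (bound := fun h => C * |V h|) univ_mem
    (Eventually.of_forall fun t => (continuous_flux u w _).measurable.aestronglyMeasurable.mul
      (Lp.aestronglyMeasurable V)) ?_
    ((measurable_fderiv_flux u w _).aestronglyMeasurable.mul (Lp.aestronglyMeasurable V)) ?_
    (hVi.abs.const_mul C) ?_
  · refine ⟨h2.1, ?_⟩
    have h3 := h2.2
    simp only [← h1] at h3
    rw [h3.unique (hV.hasDerivAt_inner hA i F), L2.inner_def]
    congr 1
    refine integral_congr_ae ?_
    filter_upwards [hFe, coeFn_coord i G] with h e1 e2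
    rw [e1, e2]
    simp [mul_comm]
  · simp only [zero_smul]
    exact (hD.memLp_flux u w).integrable_mul (Lp.memLp V)
  · filter_upwards [hK] with h hh
    refine LipschitzWith.lipschitzOnWith (LipschitzWith.of_dist_le_mul fun s t => ?_)
    rw [Real.dist_eq, ← sub_mul, abs_mul, Real.coe_nnabs,
      abs_of_nonneg (mul_nonneg hC0 (abs_nonneg (V h))), mul_right_comm]
    gcongr
    refine (hC h hh _ _).trans (le_of_eq ?_)
    rw [← sub_smul, norm_smul, Real.dist_eq]
    simp
  · exact Eventually.of_forall fun h => (hasDerivAt_flux u w _ h).mul_const _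

end

/-! ### The corrector equation and its limit. -/

section

variable {d : ℕ} {P : Measure (Surf d)} [IsProbabilityMeasure P]

/-- The constant vector field `e`. -/
def cst (P : Measure (Surf d)) [IsProbabilityMeasure P] (e : E d) : Lp (E d) 2 P :=
  Lp.constL 2 P ℝ e

theorem coeFn_cst (e : E d) : cst P e =ᵐ[P] fun _ => e := Lp.coeFn_const 2 P e

theorem coeFn_cst_add (e : E d) (G : Lp (E d) 2 P) : ⇑(cst P e + G) =ᵐ[P] fun h => e + G h := by
  filter_upwards [Lp.coeFn_add (cst P e) G, coeFn_cst (P := P) e] with h h1 h2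
  rw [h1, Pi.add_apply, h2]

theorem memLp_piMeasure (hD : BoundedDerivatives P) {f : Surf d → ℝ} (hf : MemLp f 2 P) :
    MemLp f 2 (piMeasure P) := by
  obtain ⟨A, hA0, hA⟩ := hD.exists_area_le
  have h1 : piMeasure P ≤ ENNReal.ofReal (A / Z P) • P := by
    rw [piMeasure, ← withDensity_const]
    refine withDensity_mono ?_
    filter_upwards [hA] with h hh
    have := hD.Z_pos
    gcongr
  exact hf.of_measure_le_smul ENNReal.ofReal_ne_top h1

omit [IsProbabilityMeasure P] in
theorem piMeasure_absolutelyContinuous : piMeasure P ≪ P := withDensity_absolutelyContinuous _ _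

/-- The drift is bounded: the Lipschitz constant of the flux bounds its derivatives, and the inverse
area is at most `1`. -/
theorem memLp_drift (hD : BoundedDerivatives P) (e : E d) : MemLp (drift e) 2 P := by
  obtain ⟨K, -, hK⟩ := id hD
  have h1 : ∀ j : Fin d, MemLp (fun h : Surf d =>
      (area h)⁻¹ * fderiv ℝ (flux (EuclideanSpace.single j 1) e h) 0
        (EuclideanSpace.single j 1)) 2 P := by
    intro j
    obtain ⟨C, hC0, hC⟩ := exists_lipschitz_flux (EuclideanSpace.single j 1) e K
    refine MemLp.of_bound (continuous_area.measurable.inv.mul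
      (measurable_fderiv_flux _ e _)).aestronglyMeasurable C ?_
    filter_upwards [hK] with h hh
    have h2 := abs_fderiv_flux_le hC0 (hC h hh) (EuclideanSpace.single j (1 : ℝ))
    rw [norm_mul, Real.norm_of_nonneg (inv_nonneg.2 (area_pos h).le)]
    have h3 : (area h)⁻¹ ≤ 1 := inv_le_one_of_one_le₀ (one_le_area h)
    calc _ ≤ 1 * C := by
          gcongr
          simpa using h2
      _ = C := one_mul C
  have h2 := memLp_finsetSum Finset.univ fun j _ => h1 j
  refine h2.congr_norm ?_ (Eventually.of_forall fun h => ?_)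
  · have h3 : drift e = fun h : Surf d => ∑ j, (area h)⁻¹ *
        fderiv ℝ (flux (EuclideanSpace.single j 1) e h) 0 (EuclideanSpace.single j 1) := by
      funext h
      rw [drift_eq, Finset.mul_sum]
    rw [h3]
    exact h2.1
  · rw [drift_eq, Finset.mul_sum]

theorem flux_eq_sum (e u : E d) (h : Surf d) :
    coeffForm (gradient h 0) e u = ∑ j, flux (EuclideanSpace.single j 1) e h 0 * u j := by
  conv_lhs => rw [eq_sum_smul_single u]
  rw [coeffForm_comm, coeffForm_sum_left]
  exact Finset.sum_congr rfl fun k _ => by rw [coeffForm_smul_left, flux, mul_comm]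

/-- The drift is the divergence of the flux. -/
theorem HasGrad.integral_drift (hA : Stationary P) (hD : BoundedDerivatives P)
    {ψ : Lp ℝ 2 P} {Γ : Lp (E d) 2 P} (hψ : HasGrad P ψ Γ) (e : E d) :
    ∫ h, drift e h * ψ h ∂(piMeasure P) = - dirichletForm P (cst P e) Γ := by
  have hibp := fun j => hψ.integral_fderiv_flux hA hD (EuclideanSpace.single j 1) e j
  have hi : ∀ j, Integrable (fun h => flux (EuclideanSpace.single j 1) e h 0 * Γ h j) P := fun j =>
    (hD.memLp_flux _ e).integrable_mul
      ((memLp_congr_ae (coeFn_coord j Γ)).1 (Lp.memLp (coord P j Γ)))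
  rw [hD.integral_piMeasure, dirichletForm_eq]
  have h1 : ∀ h : Surf d, area h / Z P * (drift e h * ψ h) = (Z P)⁻¹ *
      ∑ j, fderiv ℝ (flux (EuclideanSpace.single j 1) e h) 0 (EuclideanSpace.single j 1) * ψ h := by
    intro h
    rw [drift_eq, ← Finset.sum_mul]
    have := (area_pos h).ne'
    field_simp
  simp only [h1]
  rw [integral_const_mul, integral_finsetSum _ fun j _ => (hibp j).1, ← mul_neg]
  congr 1
  have h2 : ∫ h, coeffForm (gradient h 0) (cst P e h) (Γ h) ∂P =
      ∫ h, ∑ j, flux (EuclideanSpace.single j 1) e h 0 * Γ h j ∂P := by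
    refine integral_congr_ae ?_
    filter_upwards [coeFn_cst (P := P) e] with h hh
    rw [hh, flux_eq_sum]
  rw [h2, integral_finsetSum _ fun j _ => hi j, ← Finset.sum_neg_distrib]
  exact Finset.sum_congr rfl fun j _ => (hibp j).2

theorem integral_smul_sub_drift (hA : Stationary P) (hD : BoundedDerivatives P) (e : E d)
    (lam : ℝ) (χ : Lp ℝ 2 P) {ψ : Lp ℝ 2 P} {Γ : Lp (E d) 2 P} (hψ : HasGrad P ψ Γ) :
    ∫ h, (lam * χ h - drift e h) * ψ h ∂(piMeasure P) =
      lam * ∫ h, χ h * ψ h ∂(piMeasure P) + dirichletForm P (cst P e) Γ := by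
  have hψ2 := memLp_piMeasure hD (Lp.memLp ψ)
  have h1 : Integrable (fun h => χ h * ψ h) (piMeasure P) :=
    (memLp_piMeasure hD (Lp.memLp χ)).integrable_mul hψ2
  have h2 : Integrable (fun h => drift e h * ψ h) (piMeasure P) :=
    (memLp_piMeasure hD (memLp_drift hD e)).integrable_mul hψ2
  rw [← neg_neg (dirichletForm P (cst P e) Γ), ← hψ.integral_drift hA hD e, ← integral_const_mul,
    ← sub_eq_add_neg, ← integral_sub (h1.const_mul lam) h2]
  congr 1
  funext h
  ring

/-- The generator equation forces `φ = lam χ - F · e` almost everywhere; substituting this and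
integrating the drift by parts leaves only gradients on the right. -/
theorem isCorrector_iff (hA : Stationary P) (hD : BoundedDerivatives P) {e : E d} {lam : ℝ}
    {χ : Lp ℝ 2 P} {G : Lp (E d) 2 P} (hχ : HasGrad P χ G) :
    IsCorrector P e lam χ ↔ ∀ (ψ : Lp ℝ 2 P) (Γ : Lp (E d) 2 P), HasGrad P ψ Γ →
      lam * ∫ h, χ h * ψ h ∂(piMeasure P) + dirichletForm P G Γ =
        - dirichletForm P (cst P e) Γ := by
  constructor
  · rintro ⟨φ, ⟨-, G', hG', hφ⟩, heq⟩ ψ Γ hψ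
    obtain rfl := hG'.unique hA hχ
    have h1 : ∫ h, φ h * ψ h ∂(piMeasure P) =
        ∫ h, (lam * χ h - drift e h) * ψ h ∂(piMeasure P) := by
      refine integral_congr_ae ?_
      filter_upwards [piMeasure_absolutelyContinuous.ae_le heq] with h hh
      rw [← hh, sub_sub_cancel]
    have h2 := hφ ψ Γ hψ
    rw [h1, integral_smul_sub_drift hA hD e lam χ hψ] at h2
    linarith
  · intro H
    refine ⟨fun h => lam * χ h - drift e h, ⟨?_, G, hχ, fun ψ Γ hψ => ?_⟩,
      Eventually.of_forall fun h => sub_sub_cancel _ _⟩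
    · exact memLp_piMeasure hD (((Lp.memLp χ).const_mul lam).sub (memLp_drift hD e))
    · rw [integral_smul_sub_drift hA hD e lam χ hψ]
      linarith [H ψ Γ hψ]

theorem tendsto_of_isCoercive {H ι : Type*} [NormedAddCommGroup H] [InnerProductSpace ℝ H]
    {a : H →L[ℝ] H →L[ℝ] ℝ} (ha : IsCoercive a) {l : Filter ι} {u : ι → H} {v : H}
    (h : Tendsto (fun i => a (u i - v) (u i - v)) l (𝓝 0)) : Tendsto u l (𝓝 v) := by
  obtain ⟨C, hC, hCa⟩ := ha
  rw [tendsto_iff_norm_sub_tendsto_zero]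
  have h1 : Tendsto (fun i => √(C⁻¹ * a (u i - v) (u i - v))) l (𝓝 0) := by
    simpa using (h.const_mul C⁻¹).sqrt
  refine squeeze_zero (fun _ => norm_nonneg _) (fun i => ?_) h1
  refine Real.le_sqrt_of_sq_le ?_
  rw [← div_eq_inv_mul, le_div_iff₀ hC]
  linarith [hCa (u i - v)]

/-- The gradient of the corrector is characterised by the cell problem. -/
theorem exists_isGradChi_iff (hA : Stationary P) (hD : BoundedDerivatives P) (e : E d) :
    ∃ G₀ ∈ potential hA, (∀ Γ ∈ potential hA, dirichletForm P (cst P e + G₀) Γ = 0) ∧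
      ∀ G, IsGradChi P e G ↔ G = G₀ := by
  obtain ⟨a, -, ha, hco⟩ := hD.exists_bilin
  obtain ⟨b, hb, hbco⟩ := hD.exists_pi_bilin
  -- `G₀` is the `a`-orthogonal projection of `-e` onto the potential fields.
  obtain ⟨G₀, hG₀, h0⟩ := exists_mem_forall_eq a hco (potential hA) (isClosed_potential hA)
    (-(a (cst P e)))
  -- Every family of correctors has the same limit, which gives uniqueness as well as convergence.
  have hlim : ∀ (χ : ℝ → Lp ℝ 2 P) (Γ : ℝ → Lp (E d) 2 P),
      (∀ lam : ℝ, 0 < lam → IsCorrector P e lam (χ lam) ∧ HasGrad P (χ lam) (Γ lam)) →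
      Tendsto (fun lam => a (Γ lam - G₀) (Γ lam - G₀)) (𝓝[>] 0) (𝓝 0) := by
    intro χ Γ h
    refine tendsto_resolvent a (fun u => by rw [ha]; exact hD.dirichletForm_self_nonneg u)
      (fun u v => by rw [ha, ha, dirichletForm_comm]) b
      (fun u => by rw [hb]; exact integral_nonneg fun _ => mul_self_nonneg _)
      (fun u v => by rw [hb, hb]; simp only [mul_comm]) (gradGraph hA) G₀ ?_
      (fun lam => WithLp.toLp 2 (χ lam, Γ lam)) (fun lam hlam => (h lam hlam).2) ?_
    · exact mem_potential.1 hG₀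
    · intro lam hlam q hq
      have h1 := (isCorrector_iff hA hD (h lam hlam).2).1 (h lam hlam).1 _ _ hq
      have h2 := h0 q.snd (HasGrad.mem_potential hA hq)
      rw [map_sub, _root_.sub_apply, h2, hb, ha]
      change lam * ∫ h, χ lam h * q.fst h ∂(piMeasure P) + (dirichletForm P (Γ lam) q.snd -
        -(a (cst P e) q.snd)) = 0
      rw [ha]
      linarith
  refine ⟨G₀, hG₀, fun Γ hΓ => ?_, fun G => ⟨?_, ?_⟩⟩
  · rw [← ha, map_add, _root_.add_apply, h0 Γ hΓ]
    exact add_neg_cancel (a (cst P e) Γ)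
  · rintro ⟨χ, Γ, h, hG⟩
    simp only [← ha] at hG
    exact tendsto_nhds_unique (tendsto_of_isCoercive hco hG)
      (tendsto_of_isCoercive hco (hlim χ Γ h))
  · rintro rfl
    have h1 := fun lam (hlam : 0 < lam) =>
      exists_resolvent a hco b hbco (gradGraph hA) (isClosed_gradGraph hA) hlam (-(a (cst P e)))
    choose! p hp hpe using h1
    have h2 : ∀ lam : ℝ, 0 < lam →
        IsCorrector P e lam (p lam).fst ∧ HasGrad P (p lam).fst (p lam).snd := by
      refine fun lam hlam => ⟨(isCorrector_iff hA hD (hp lam hlam)).2 fun ψ Γ hψ => ?_, hp lam hlam⟩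
      have h3 := hpe lam hlam (WithLp.toLp 2 (ψ, Γ)) hψ
      rw [hb, ha] at h3
      refine h3.trans ?_
      rw [← ha]
      rfl
    refine ⟨fun lam => (p lam).fst, fun lam => (p lam).snd, h2, ?_⟩
    simp only [← ha]
    exact hlim _ _ h2

end

/-! ### Cell problem, variational formula and effective tensor. -/

section

variable {d : ℕ} {P : Measure (Surf d)} [IsProbabilityMeasure P]

/-- Existence and uniqueness together ensure that the choice in `gradChi` returns the true limit. -/
theorem isGradChi_iff (hA : Stationary P) (hD : BoundedDerivatives P) (e : E d)
    (G : Lp (E d) 2 P) : IsGradChi P e G ↔ G = gradChi P e := by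
  obtain ⟨G₀, -, -, h⟩ := exists_isGradChi_iff hA hD e
  have h1 : IsGradChi P e (gradChi P e) := Classical.epsilon_spec ⟨G₀, (h G₀).2 rfl⟩
  rw [h, (h _).1 h1]

theorem gradChi_mem (hA : Stationary P) (hD : BoundedDerivatives P) (e : E d) :
    gradChi P e ∈ potential hA := by
  obtain ⟨G₀, h0, -, h⟩ := exists_isGradChi_iff hA hD e
  rwa [← (isGradChi_iff hA hD e G₀).1 ((h G₀).2 rfl)]

/-- The cell problem. -/
theorem dirichletForm_cst_add_gradChi (hA : Stationary P) (hD : BoundedDerivatives P) (e : E d)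
    {Γ : Lp (E d) 2 P} (hΓ : Γ ∈ potential hA) :
    dirichletForm P (cst P e + gradChi P e) Γ = 0 := by
  obtain ⟨G₀, -, h0, h⟩ := exists_isGradChi_iff hA hD e
  rw [← (isGradChi_iff hA hD e G₀).1 ((h G₀).2 rfl)]
  exact h0 Γ hΓ

theorem eq_zero_of_dirichletForm_nonpos (hD : BoundedDerivatives P) {G : Lp (E d) 2 P}
    (h : dirichletForm P G G ≤ 0) : G = 0 := by
  obtain ⟨a, -, ha, C, hC, hCa⟩ := hD.exists_bilin
  have h1 := hCa G
  rw [ha, mul_assoc] at h1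
  have h2 : ‖G‖ * ‖G‖ ≤ 0 := by
    by_contra h3
    have := mul_pos hC (not_le.1 h3)
    linarith
  exact norm_eq_zero.1 (mul_self_eq_zero.1 (le_antisymm h2 (mul_self_nonneg _)))

/-- Pythagoras: the cell problem makes the cross term vanish. The second summand is the excess
energy of a competitor. -/
theorem dirichletForm_cst_add (hA : Stationary P) (hD : BoundedDerivatives P) (e : E d)
    {V : Lp (E d) 2 P} (hV : V ∈ potential hA) :
    dirichletForm P (cst P e + V) (cst P e + V) =
      dirichletForm P (cst P e + gradChi P e) (cst P e + gradChi P e) +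
        dirichletForm P (V - gradChi P e) (V - gradChi P e) := by
  obtain ⟨a, -, ha, -⟩ := hD.exists_bilin
  have h0 := dirichletForm_cst_add_gradChi hA hD e
    ((potential hA).sub_mem hV (gradChi_mem hA hD e))
  have h1 := form_add a (fun u v => by rw [ha, ha, dirichletForm_comm])
    (cst P e + gradChi P e) (V - gradChi P e)
  rw [ha, ha, ha, ha, h0, add_add_sub_cancel] at h1
  linarith

theorem inv_Z_mul_cellEnergy (e : E d) (V : Lp (E d) 2 P) :
    (Z P)⁻¹ * cellEnergy P e V = dirichletForm P (cst P e + V) (cst P e + V) := by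
  rw [cellEnergy, dirichletForm]
  congr 1
  refine integral_congr_ae ?_
  filter_upwards [coeFn_cst_add e V] with h hh
  rw [hh]

theorem cellEnergy_le_iff (hD : BoundedDerivatives P) (e : E d) (V W : Lp (E d) 2 P) :
    cellEnergy P e V ≤ cellEnergy P e W ↔ dirichletForm P (cst P e + V) (cst P e + V) ≤
      dirichletForm P (cst P e + W) (cst P e + W) := by
  rw [← inv_Z_mul_cellEnergy, ← inv_Z_mul_cellEnergy]
  exact (mul_le_mul_iff_right₀ (inv_pos.2 hD.Z_pos)).symm

theorem cellEnergy_gradChi_le (hA : Stationary P) (hD : BoundedDerivatives P) (e : E d)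
    {V : Lp (E d) 2 P} (hV : V ∈ L2pot P) : cellEnergy P e (gradChi P e) ≤ cellEnergy P e V := by
  rw [cellEnergy_le_iff hD, dirichletForm_cst_add hA hD e (mem_potential.2 hV)]
  exact le_add_of_nonneg_right (hD.dirichletForm_self_nonneg _)

theorem eq_gradChi_of_cellEnergy_le (hA : Stationary P) (hD : BoundedDerivatives P) (e : E d)
    {V : Lp (E d) 2 P} (hV : V ∈ L2pot P)
    (h : cellEnergy P e V ≤ cellEnergy P e (gradChi P e)) : V = gradChi P e := by
  rw [cellEnergy_le_iff hD, dirichletForm_cst_add hA hD e (mem_potential.2 hV)] at h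
  exact sub_eq_zero.1 (eq_zero_of_dirichletForm_nonpos hD (by linarith))

theorem cst_eq_sum (e : E d) :
    cst P e = ∑ k, e k • cst P (EuclideanSpace.single k (1 : ℝ)) := by
  conv_lhs => rw [eq_sum_smul_single e, cst, map_sum]
  exact Finset.sum_congr rfl fun k _ => map_smul _ _ _

/-- Linearity in `e`: both sides solve the same cell problem and differ by a potential field, which
is therefore orthogonal to itself. -/
theorem sum_smul_cst_add_gradChi (hA : Stationary P) (hD : BoundedDerivatives P) (e : E d) :
    ∑ k, e k • (cst P (EuclideanSpace.single k (1 : ℝ)) +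
      gradChi P (EuclideanSpace.single k (1 : ℝ))) = cst P e + gradChi P e := by
  obtain ⟨a, -, ha, -⟩ := hD.exists_bilin
  simp only [smul_add, Finset.sum_add_distrib, ← cst_eq_sum]
  congr 1
  set W := ∑ k, e k • gradChi P (EuclideanSpace.single k (1 : ℝ)) with hW
  have hWm : W ∈ potential hA :=
    Submodule.sum_mem _ fun k _ => Submodule.smul_mem _ _ (gradChi_mem hA hD _)
  have h1 : ∀ Γ ∈ potential hA, dirichletForm P (cst P e + W) Γ = 0 := by
    intro Γ hΓ
    rw [cst_eq_sum, hW, ← Finset.sum_add_distrib, ← ha, map_sum, _root_.sum_apply]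
    refine Finset.sum_eq_zero fun k _ => ?_
    rw [← smul_add, map_smul, _root_.smul_apply, ha, dirichletForm_cst_add_gradChi hA hD _ hΓ,
      smul_zero]
  have h2 := (potential hA).sub_mem hWm (gradChi_mem hA hD e)
  refine sub_eq_zero.1 (eq_zero_of_dirichletForm_nonpos hD (le_of_eq ?_))
  have h3 : W - gradChi P e = (cst P e + W) - (cst P e + gradChi P e) := by abel
  conv_lhs => lhs; rw [h3]
  rw [← ha, map_sub a, _root_.sub_apply, ha, ha, h1 _ h2,
    dirichletForm_cst_add_gradChi hA hD e h2, sub_zero]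

/-- Row `i` of `I + 𝔻χ` is the field `eᵢ + 𝔻χ^{eᵢ}`, so the matrix product collects the pairings of
these fields. -/
theorem effTensor_apply (i j : Fin d) :
    effTensor P i j = dirichletForm P
      (cst P (EuclideanSpace.single i 1) + gradChi P (EuclideanSpace.single i 1))
      (cst P (EuclideanSpace.single j 1) + gradChi P (EuclideanSpace.single j 1)) := by
  rw [effTensor, of_apply, dirichletForm]
  congr 1
  refine integral_congr_ae ?_
  filter_upwards [coeFn_cst_add (EuclideanSpace.single i 1) (gradChi P (EuclideanSpace.single i 1)),
    coeFn_cst_add (EuclideanSpace.single j 1) (gradChi P (EuclideanSpace.single j 1))] with h h1 h2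
  rw [h1, h2]
  congr 1
  have h3 : ∀ i, (1 + gradChiMatrix P h) i =
      (EuclideanSpace.single i 1 + gradChi P (EuclideanSpace.single i 1) h : E d).ofLp := by
    intro i
    ext k
    simp [gradChiMatrix, Matrix.one_apply, eq_comm]
  rw [Matrix.mul_assoc, form, ← h3, ← h3]
  rfl

theorem form_effTensor (hA : Stationary P) (hD : BoundedDerivatives P) (e : E d) :
    form (effTensor P) e e =
      dirichletForm P (cst P e + gradChi P e) (cst P e + gradChi P e) := by
  obtain ⟨a, -, ha, -⟩ := hD.exists_bilin
  rw [← sum_smul_cst_add_gradChi hA hD e, ← ha]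
  simp only [map_sum, _root_.sum_apply, map_smul, _root_.smul_apply, smul_eq_mul, ha,
    ← effTensor_apply, form, dotProduct, mulVec, Finset.mul_sum]
  rw [Finset.sum_comm]
  exact Finset.sum_congr rfl fun i _ => Finset.sum_congr rfl fun j _ => by ring

omit [IsProbabilityMeasure P] in
theorem cellEnergy_eq (e : E d) (V : Lp (E d) 2 P) :
    cellEnergy P e V = ∫ h, coeffForm (gradient h 0) (e + V h) (e + V h) ∂P := by
  rw [cellEnergy]
  congr 1
  funext h
  exact form_metric_inv 0 h _ _

theorem form_effTensor_eq_cellEnergy (hA : Stationary P) (hD : BoundedDerivatives P) (e : E d) :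
    form (effTensor P) e e = (Z P)⁻¹ * cellEnergy P e (gradChi P e) := by
  rw [form_effTensor hA hD, inv_Z_mul_cellEnergy]

/-! ### Voigt-Reuss and depletion bounds by duality. -/

theorem g_apply (h : Surf d) (i j : Fin d) :
    g h i j = (1 : Matrix (Fin d) (Fin d) ℝ) i j + gradient h 0 i * gradient h 0 j := rfl

theorem form_g (h : Surf d) (p : E d) :
    form (g h) p p = ‖p‖ ^ 2 + inner ℝ (gradient h 0) p ^ 2 := by
  rw [form, g, metric, add_mulVec, vecMulVec_mulVec, one_mulVec, dotProduct_add, op_smul_eq_smul,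
    dotProduct_smul, dotProduct_comm p.ofLp (gradient h 0).ofLp, ← inner_eq_dotProduct,
    ← inner_eq_dotProduct, real_inner_self_eq_norm_sq, smul_eq_mul, sq (inner ℝ _ _)]

theorem BoundedDerivatives.integrable_g_div_area (hD : BoundedDerivatives P) (i j : Fin d) :
    Integrable (fun h => g h i j / area h) P := by
  obtain ⟨K, hK0, hK⟩ := hD
  have hc : Continuous fun h : Surf d => g h i j := by
    have h1 := continuous_gradient (0 : E d)
    have h2 : ∀ i, Continuous fun h : Surf d => gradient h 0 i := fun i =>
      (EuclideanSpace.proj i : E d →L[ℝ] ℝ).continuous.comp h1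
    exact continuous_const.add ((h2 i).mul (h2 j))
  refine Integrable.of_bound (hc.measurable.div continuous_area.measurable).aestronglyMeasurable
    (1 + K * K) ?_
  filter_upwards [hK] with h hh
  have h1 : ∀ i, |gradient h 0 i| ≤ K := fun i =>
    ((PiLp.norm_apply_le (gradient h 0) i).trans (le_add_of_nonneg_right (norm_nonneg _))).trans
      (hh 0)
  have h2 : |(1 : Matrix (Fin d) (Fin d) ℝ) i j| ≤ 1 := by
    rw [Matrix.one_apply]
    split_ifs <;> simp
  rw [norm_div, Real.norm_of_nonneg (area_pos h).le]
  refine (div_le_self (norm_nonneg _) (one_le_area h)).trans ?_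
  rw [g_apply, Real.norm_eq_abs]
  refine (abs_add_le _ _).trans (add_le_add h2 ?_)
  rw [abs_mul]
  gcongr <;> apply h1

omit [IsProbabilityMeasure P] in
theorem form_of_integral {A : Surf d → Matrix (Fin d) (Fin d) ℝ}
    (hi : ∀ i j, Integrable (fun h => A h i j) P) (p : E d) :
    Integrable (fun h => form (A h) p p) P ∧
      form (Matrix.of fun i j => ∫ h, A h i j ∂P) p p = ∫ h, form (A h) p p ∂P := by
  simp only [form, dotProduct, mulVec, Finset.mul_sum]
  have h1 : ∀ i j, Integrable (fun h => p i * (A h i j * p j)) P := fun i j =>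
    ((hi i j).mul_const _).const_mul _
  refine ⟨integrable_finsetSum _ fun i _ => integrable_finsetSum _ fun j _ => h1 i j, ?_⟩
  rw [integral_finsetSum _ fun i _ => integrable_finsetSum _ fun j _ => h1 i j]
  refine Finset.sum_congr rfl fun i _ => ?_
  rw [integral_finsetSum _ fun j _ => h1 i j]
  refine Finset.sum_congr rfl fun j _ => ?_
  rw [integral_const_mul, integral_mul_const]
  rfl

theorem form_smul (c : ℝ) (A : Matrix (Fin d) (Fin d) ℝ) (u v : E d) :
    form (c • A) u v = c * form A u v := by
  rw [form, smul_mulVec, dotProduct_smul, form, smul_eq_mul]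

theorem form_div (h : Surf d) (A : Matrix (Fin d) (Fin d) ℝ) (u v : E d) :
    form (Matrix.of fun i j => A i j / area h) u v = form A u v / area h := by
  have h1 : (Matrix.of fun i j => A i j / area h) = (area h)⁻¹ • A := by
    ext i j
    simp [div_eq_inv_mul]
  rw [h1, form_smul, div_eq_inv_mul]

/-- The mean of `g / √|g|`, whose inverse is the Reuss bound. -/
def reussMatrix (P : Measure (Surf d)) : Matrix (Fin d) (Fin d) ℝ :=
  Matrix.of fun i j => ∫ h, g h i j / area h ∂P

theorem form_reussMatrix (hD : BoundedDerivatives P) (p : E d) :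
    Integrable (fun h : Surf d => (‖p‖ ^ 2 + inner ℝ (gradient h 0) p ^ 2) / area h) P ∧
      form (reussMatrix P) p p =
        ∫ h : Surf d, (‖p‖ ^ 2 + inner ℝ (gradient h 0) p ^ 2) / area h ∂P := by
  have h1 := form_of_integral (P := P) (A := fun h => Matrix.of fun i j => g h i j / area h)
    (fun i j => hD.integrable_g_div_area i j) p
  simp only [form_div, form_g] at h1
  exact h1

theorem reussMatrix_posDef (hD : BoundedDerivatives P) : (reussMatrix P).PosDef := by
  refine Matrix.PosDef.of_dotProduct_mulVec_pos ?_ fun x hx => ?_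
  · ext i j
    simp only [reussMatrix, conjTranspose_apply, of_apply, star_trivial, g_apply, mul_comm,
      Matrix.one_apply, eq_comm]
  · obtain ⟨hi, h1⟩ := form_reussMatrix hD (WithLp.toLp 2 x)
    change 0 < form (reussMatrix P) (WithLp.toLp 2 x) (WithLp.toLp 2 x)
    have hx' : 0 < ‖(WithLp.toLp 2 x : E d)‖ ^ 2 := by
      have : (WithLp.toLp 2 x : E d) ≠ 0 := fun h => hx (congrArg WithLp.ofLp h)
      positivity
    have hpos : ∀ h : Surf d, 0 < (‖(WithLp.toLp 2 x : E d)‖ ^ 2 +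
        inner ℝ (gradient h 0) (WithLp.toLp 2 x) ^ 2) / area h := fun h =>
      div_pos (by positivity) (area_pos h)
    rw [h1, integral_pos_iff_support_of_nonneg (fun h => (hpos h).le) hi]
    have : (Function.support fun h : Surf d => (‖(WithLp.toLp 2 x : E d)‖ ^ 2 +
        inner ℝ (gradient h 0) (WithLp.toLp 2 x) ^ 2) / area h) = Set.univ :=
      Set.eq_univ_of_forall fun h => (hpos h).ne'
    rw [this, measure_univ]
    exact one_pos

/-- Dual lower bound for the cell energy. -/
theorem le_cellEnergy (hA : Stationary P) (hD : BoundedDerivatives P) (e p : E d)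
    {V : Lp (E d) 2 P} (hV : V ∈ L2pot P) :
    2 * inner ℝ p e - form (reussMatrix P) p p ≤ cellEnergy P e V := by
  obtain ⟨a, hint, -, -⟩ := hD.exists_bilin
  obtain ⟨hi, h1⟩ := form_reussMatrix hD p
  have hpV : Integrable (fun h => inner ℝ p (V h)) P :=
    (integrable_of_Lp V).const_inner p
  have hl : Integrable (fun h => 2 * (inner ℝ p e + inner ℝ p (V h))) P :=
    ((integrable_const _).add hpV).const_mul 2
  have h2 : 2 * inner ℝ p e = ∫ h, 2 * (inner ℝ p e + inner ℝ p (V h)) ∂P := by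
    rw [integral_const_mul, integral_add (integrable_const _) hpV,
      integral_inner_potential hA (mem_potential.2 hV)]
    simp
  rw [h1, h2, ← integral_sub hl hi, cellEnergy_eq]
  refine integral_mono (hl.sub hi) ?_ fun h => ?_
  · refine (hint (cst P e + V) (cst P e + V)).congr ?_
    filter_upwards [coeFn_cst_add e V] with h hh
    rw [hh]
  · dsimp only
    rw [← inner_add_right, area_eq]
    exact two_inner_sub_le_coeffForm _ _ _

/-- The largest eigenvalue of `g` is at most `|g| = 1 + |∇h|²`, so `g/√|g| ≤ √|g|` pointwise. -/
theorem form_reussMatrix_le (hD : BoundedDerivatives P) (p : E d) :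
    form (reussMatrix P) p p ≤ ‖p‖ ^ 2 * Z P := by
  obtain ⟨hi, h1⟩ := form_reussMatrix hD p
  rw [h1, Z, ← integral_const_mul]
  refine integral_mono hi (hD.integrable_area.const_mul _) fun h => ?_
  dsimp only
  have h2 : area h * area h = 1 + ‖gradient h 0‖ ^ 2 := by
    rw [area_eq, Real.mul_self_sqrt (by positivity)]
  have h3 : inner ℝ (gradient h 0) p ^ 2 ≤ (‖gradient h 0‖ * ‖p‖) ^ 2 := by
    rw [← sq_abs]
    gcongr
    exact abs_real_inner_le_norm _ _
  rw [div_le_iff₀ (area_pos h), mul_assoc, h2]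
  linarith [mul_pow ‖gradient h 0‖ ‖p‖ 2]

theorem norm_sq_div_le_cellEnergy (hA : Stationary P) (hD : BoundedDerivatives P) (e : E d)
    {V : Lp (E d) 2 P} (hV : V ∈ L2pot P) : ‖e‖ ^ 2 / Z P ≤ cellEnergy P e V := by
  have hZ := hD.Z_pos
  -- `p = e/Z` maximises `2 p · e - Z |p|²`, the dual bound after `M` is replaced by `Z`.
  have h1 := le_cellEnergy hA hD e ((Z P)⁻¹ • e) hV
  have h2 := form_reussMatrix_le hD ((Z P)⁻¹ • e)
  rw [real_inner_smul_left, real_inner_self_eq_norm_sq] at h1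
  rw [norm_smul, mul_pow, Real.norm_of_nonneg (by positivity)] at h2
  have h3 : (Z P)⁻¹ ^ 2 * ‖e‖ ^ 2 * Z P = (Z P)⁻¹ * ‖e‖ ^ 2 := by field_simp
  rw [div_eq_inv_mul]
  linarith

theorem form_lowerTensor_le (hA : Stationary P) (hD : BoundedDerivatives P) (e : E d)
    {V : Lp (E d) 2 P} (hV : V ∈ L2pot P) :
    form (lowerTensor P) e e ≤ (Z P)⁻¹ * cellEnergy P e V := by
  rw [lowerTensor, form_smul]
  have hZ := hD.Z_pos
  gcongr
  -- The optimal dual field `p = M⁻¹e`, with `M` the Reuss matrix, turns the bound into `e · M⁻¹e`.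
  have h1 := le_cellEnergy hA hD e (WithLp.toLp 2 ((reussMatrix P)⁻¹ *ᵥ e.ofLp)) hV
  have h2 : reussMatrix P *ᵥ ((reussMatrix P)⁻¹ *ᵥ e.ofLp) = e.ofLp := by
    rw [mulVec_mulVec, mul_nonsing_inv _ (reussMatrix_posDef hD).det_pos.ne'.isUnit, one_mulVec]
  rw [form, inner_eq_dotProduct] at h1
  simp only [h2] at h1
  rw [form, dotProduct_comm]
  change ((reussMatrix P)⁻¹ *ᵥ e.ofLp) ⬝ᵥ e.ofLp ≤ _
  linarith

omit [IsProbabilityMeasure P] in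
theorem cellEnergy_zero (e : E d) :
    cellEnergy P e 0 = ∫ h, coeffForm (gradient h 0) e e ∂P := by
  rw [cellEnergy_eq]
  refine integral_congr_ae ?_
  filter_upwards [Lp.coeFn_zero (E d) 2 P] with h hh
  rw [hh, Pi.zero_apply, add_zero]

theorem form_upperTensor (hD : BoundedDerivatives P) (e : E d) :
    form (upperTensor P) e e = (Z P)⁻¹ * cellEnergy P e 0 := by
  have h1 := form_of_integral (P := P) (A := fun h => area h • (g h)⁻¹)
    (fun i j => by
      refine ((hD.memLp_flux (EuclideanSpace.single i 1) (EuclideanSpace.single j 1)).integrable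
        one_le_two).congr (Eventually.of_forall fun h => ?_)
      exact (areaAt_mul_metric_inv 0 h i j).symm) e
  rw [upperTensor, form_smul, cellEnergy_zero]
  congr 1
  have h2 : ∀ h : Surf d, form (area h • (g h)⁻¹) e e = coeffForm (gradient h 0) e e := by
    intro h
    rw [form_smul, mul_comm]
    exact form_metric_inv 0 h e e
  simp only [h2] at h1
  rw [← h1.2]
  simp only [Matrix.smul_apply, smul_eq_mul, mul_comm]

theorem cellEnergy_zero_le (hD : BoundedDerivatives P) (e : E d) :
    cellEnergy P e 0 ≤ ‖e‖ ^ 2 * Z P := by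
  rw [cellEnergy_zero, Z, ← integral_const_mul]
  refine integral_mono ((hD.memLp_flux e e).integrable one_le_two)
    (hD.integrable_area.const_mul _) fun h => ?_
  dsimp only
  rw [area_eq]
  exact coeffForm_self_le _ _

theorem effTensor_posDef (hA : Stationary P) (hD : BoundedDerivatives P) :
    (effTensor P).PosDef := by
  refine Matrix.PosDef.of_dotProduct_mulVec_pos ?_ fun x hx => ?_
  · ext i j
    rw [conjTranspose_apply, star_trivial, effTensor_apply, effTensor_apply, dirichletForm_comm]
  · change 0 < form (effTensor P) (WithLp.toLp 2 x) (WithLp.toLp 2 x)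
    have hx' : (WithLp.toLp 2 x : E d) ≠ 0 := fun h => hx (congrArg WithLp.ofLp h)
    have hZ := hD.Z_pos
    rw [form_effTensor_eq_cellEnergy hA hD]
    refine mul_pos (inv_pos.2 hZ) (lt_of_lt_of_le ?_
      (norm_sq_div_le_cellEnergy hA hD _ (mem_potential.1 (gradChi_mem hA hD _))))
    positivity

end

end RandomSurface

end

theorem theorem5p2 {d : ℕ} (P : Measure (Surf d)) [IsProbabilityMeasure P]
    (hA : Stationary P) (hB : ErgodicField P) (hC : StochasticallyContinuous P)
    (hD : BoundedDerivatives P) :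
    -- the limit of the correctors exists and is unique, so that the effective tensor is defined
    (∀ e : E d, ∃! G : Lp (E d) 2 P, IsGradChi P e G) ∧
    -- strict positive definiteness
    (effTensor P).PosDef ∧
    -- variational formula, with its unique minimiser
    (∀ e : E d,
      form (effTensor P) e e = (Z P)⁻¹ * ⨅ V : L2pot P, cellEnergy P e (V : Lp (E d) 2 P)) ∧
    (∀ e : E d, gradChi P e ∈ L2pot P ∧
      (∀ V ∈ L2pot P, cellEnergy P e (gradChi P e) ≤ cellEnergy P e V) ∧
      (∀ V ∈ L2pot P, (∀ W ∈ L2pot P, cellEnergy P e V ≤ cellEnergy P e W) →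
        V = gradChi P e)) ∧
    -- Voigt-Reuss bounds
    (∀ e : E d, form (lowerTensor P) e e ≤ form (effTensor P) e e ∧
      form (effTensor P) e e ≤ form (upperTensor P) e e) ∧
    -- depletion
    (∀ e : E d, ‖e‖ = 1 →
      1 / (Z P) ^ 2 ≤ form (effTensor P) e e ∧ form (effTensor P) e e ≤ 1) := by
  have hmem : ∀ e, gradChi P e ∈ L2pot P := fun e => mem_potential.1 (gradChi_mem hA hD e)
  have hZ := hD.Z_pos
  refine ⟨fun e => ⟨gradChi P e, (isGradChi_iff hA hD e _).2 rfl,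
    fun G hG => (isGradChi_iff hA hD e G).1 hG⟩, effTensor_posDef hA hD, fun e => ?_,
    fun e => ⟨hmem e, fun V hV => cellEnergy_gradChi_le hA hD e hV,
      fun V hV h => eq_gradChi_of_cellEnergy_le hA hD e hV (h _ (hmem e))⟩, fun e => ?_,
    fun e he => ?_⟩
  · rw [form_effTensor_eq_cellEnergy hA hD]
    congr 1
    -- The infimum is attained at the corrector, so it is a genuine minimum.
    have hleast : IsLeast (Set.range fun V : L2pot P => cellEnergy P e (V : Lp (E d) 2 P))
        (cellEnergy P e (gradChi P e)) := by
      refine ⟨⟨⟨gradChi P e, hmem e⟩, rfl⟩, ?_⟩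
      rintro _ ⟨V, rfl⟩
      exact cellEnergy_gradChi_le hA hD e V.2
    exact hleast.csInf_eq.symm
  · rw [form_effTensor_eq_cellEnergy hA hD, form_upperTensor hD]
    refine ⟨form_lowerTensor_le hA hD e (hmem e), ?_⟩
    gcongr
    exact cellEnergy_gradChi_le hA hD e (mem_potential.1 (potential hA).zero_mem)
  · rw [form_effTensor_eq_cellEnergy hA hD]
    have h1 := norm_sq_div_le_cellEnergy hA hD e (hmem e)
    have h2 := (cellEnergy_gradChi_le hA hD e (mem_potential.1 (potential hA).zero_mem)).trans
      (cellEnergy_zero_le hD e)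
    rw [he, one_pow] at h1 h2
    rw [one_mul] at h2
    constructor
    · calc 1 / Z P ^ 2 = (Z P)⁻¹ * (1 / Z P) := by field_simp
        _ ≤ _ := by gcongr
    · rw [inv_mul_le_iff₀ hZ, mul_one]
      exact h2
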